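/- A closed $n$-manifold is a compact Hausdorff smooth ($C^\infty$) manifold of dimension $n$ without boundary; the empty manifold is allowed. Two closed $n$-manifolds $M,N$ are cobordant if there is a compact Hausdorff smooth $(n+1)$-manifold with boundary $W$ and a smooth embedding $M\sqcup N\to W$ whose image is $\partial W$ (that is, $\partial W$ is diffeomorphic to the disjoint union $M\sqcup N$); $M$ is nullbordant if it is cobordant with the empty manifold. Theorem (Every one-dimensional manifold is nullbordant). 1. Every closed $1$-manifold is a finite (possibly empty) disjoint union of circles: it is partitioned into finitely many open subsets, each diffeomorphic to the unit circle $S^1\subset\mathbb{R}^2$. 2. Every circle bounds a disc: the closed unit disc $D^2\subset\mathbb{R}^2$ has a structure of smooth manifold with boundary for which the inclusion $D^2\to\mathbb{R}^2$ is a smooth embedding, and for every closed $1$-manifold $C$ and every diffeomorphism $\Phi\colon C\to S^1$ the composite $C\xrightarrow{\Phi}S^1\hookrightarrow D^2$ is a smooth embedding with image $\partial D^2$. 3. Every closed $1$-manifold is nullbordant. 4. Cobordism is an equivalence relation on closed $1$-manifolds, and there is exactly one cobordism class of closed $1$-manifolds. -/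

import Mathlib

open scoped Manifold ContDiff

universe u

/-- A closed smooth `n`-manifold: a compact Hausdorff space with a smooth atlas modelled on `ℝⁿ`.
The model has no boundary, and second countability follows from compactness. The empty manifold is
allowed. -/
structure ClosedManifold (n : ℕ) : Type (u + 1) where
  carrier : Type u
  [topologicalSpace : TopologicalSpace carrier]
  [t2Space : T2Space carrier]
  [compactSpace : CompactSpace carrier]
  [chartedSpace : ChartedSpace (EuclideanSpace ℝ (Fin n)) carrier]
  [isManifold : IsManifold (𝓡 n) ∞ carrier]

namespace ClosedManifold

instance (n : ℕ) : CoeSort (ClosedManifold.{u} n) (Type u) := ⟨carrier⟩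

attribute [instance] topologicalSpace t2Space compactSpace chartedSpace isManifold

/-- The empty set as a closed `n`-manifold. -/
def empty (n : ℕ) : ClosedManifold.{u} n :=
  letI : ChartedSpace (EuclideanSpace ℝ (Fin n)) PEmpty.{u + 1} := ChartedSpace.empty _ _
  { carrier := PEmpty.{u + 1} }

end ClosedManifold

/-- `ι` identifies the `n`-manifold `M` with the boundary of the `(n+1)`-manifold with boundary
`W`: it is a smooth embedding whose image is `∂W`. -/
def IsBoundaryParametrization (n : ℕ) {M W : Type*}
    [TopologicalSpace M] [ChartedSpace (EuclideanSpace ℝ (Fin n)) M]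
    [TopologicalSpace W] [ChartedSpace (EuclideanHalfSpace (n + 1)) W] (ι : M → W) : Prop :=
  Manifold.IsSmoothEmbedding (𝓡 n) (𝓡∂ (n + 1)) ∞ ι ∧
    Set.range ι = (𝓡∂ (n + 1)).boundary W

namespace ClosedManifold

/-- `M` and `N` are cobordant: there is a compact smooth `(n+1)`-manifold with boundary whose
boundary is (diffeomorphic to) the disjoint union of `M` and `N`. -/
def Cobordant {n : ℕ} (M N : ClosedManifold.{u} n) : Prop :=
  ∃ (W : Type u) (_ : TopologicalSpace W) (_ : ChartedSpace (EuclideanHalfSpace (n + 1)) W),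
    T2Space W ∧ CompactSpace W ∧ IsManifold (𝓡∂ (n + 1)) ∞ W ∧
      ∃ ι : M ⊕ N → W, IsBoundaryParametrization n ι

/-- `M` is nullbordant: it is cobordant with the empty manifold. -/
def Nullbordant {n : ℕ} (M : ClosedManifold.{u} n) : Prop :=
  Cobordant M (empty n)

end ClosedManifold

/-- The unit circle in the plane, with Mathlib's smooth structure on spheres. -/
abbrev UnitCircle : Type := Metric.sphere (0 : EuclideanSpace ℝ (Fin 2)) 1

/-- The closed unit disc in the plane. -/
abbrev UnitDisc : Type := Metric.closedBall (0 : EuclideanSpace ℝ (Fin 2)) 1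

/-- The inclusion of the unit circle in the closed unit disc. -/
def circleToDisc : UnitCircle → UnitDisc := Set.inclusion Metric.sphere_subset_closedBall

/-- `M` is a finite disjoint union of circles: it is partitioned into finitely many open subsets,
each diffeomorphic to the circle. -/
def ClosedManifold.IsFiniteDisjointUnionOfCircles (M : ClosedManifold.{u} 1) : Prop :=
  ∃ (k : ℕ) (U : Fin k → TopologicalSpace.Opens M),
    Pairwise (fun i j => Disjoint (U i) (U j)) ∧ (⨆ i, U i) = ⊤ ∧
      ∀ i, Nonempty (Diffeomorph (𝓡 1) (𝓡 1) (U i) UnitCircle ∞)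

/-- Every circle bounds a disc: the closed unit disc is a smooth manifold with boundary, smoothly
embedded in the plane (this determines its smooth structure), and every manifold `C` diffeomorphic
to the unit circle is identified with the boundary of the disc by the diffeomorphism followed by
the inclusion of the unit circle. -/
def EveryCircleBoundsDisc : Prop :=
  ∃ _ : ChartedSpace (EuclideanHalfSpace 2) UnitDisc,
    IsManifold (𝓡∂ 2) ∞ UnitDisc ∧
    Manifold.IsSmoothEmbedding (𝓡∂ 2) (𝓡 2) ∞
      (Subtype.val : UnitDisc → EuclideanSpace ℝ (Fin 2)) ∧
    ∀ (C : ClosedManifold.{u} 1) (Φ : Diffeomorph (𝓡 1) (𝓡 1) C UnitCircle ∞),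
      IsBoundaryParametrization 1 (circleToDisc ∘ Φ)

/-!
Embed the closed 1-manifold in a Euclidean space. Arc length then gives local coordinates whose
transition maps have the form `t ↦ ±t + c`, so a unit speed curve extends over any chart and is
determined by its germ. By compactness it extends to all times; its image is open and closed, hence
a connected component, and it is not injective because the line is not compact. A unit speed curve
that returns to a point is periodic (traversing itself backwards would make it fold at the
midpoint), so each component is `ℝ / Tℤ`. Applied to the unit circle, the same argument shows that
all these quotients are diffeomorphic to it.

Hence every closed 1-manifold, in particular a disjoint union `M ⊔ N`, bounds as many discs as it
has components, so any two closed 1-manifolds are cobordant. The disc is a manifold with boundary by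
collar coordinates: a chart of the circle in the direction `x / ‖x‖` together with `1 - ‖x‖`.
-/

open Set Filter Topology

section Extension

theorem exists_eqOn_Iic_forall_ge {α : Type*} {P : (ℝ → α) → ℝ → Prop}
    (congr : ∀ {f g t}, P f t → f =ᶠ[𝓝 t] g → P g t) {d : ℝ} (hd : 0 < d)
    (step : ∀ f b, P f b → ∃ g, EqOn g f (Iic b) ∧ ∀ t ∈ Icc b (b + d), P g t)
    {f : ℝ → α} {b : ℝ} (hf : P f b) :
    ∃ g, EqOn g f (Iic b) ∧ ∀ t, b ≤ t → P g t := by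
  choose! next next_eqOn next_spec using step
  let c : ℕ → ℝ → α := Nat.rec f fun n g => next g (b + n * d)
  have add_d (n : ℕ) : b + n * d + d = b + (n + 1 : ℕ) * d := by push_cast; ring
  have hc (n : ℕ) : P (c n) (b + n * d) := by
    induction n with
    | zero => simpa [c] using hf
    | succ n ih => exact next_spec _ _ ih _ ⟨by rw [← add_d]; linarith, (add_d n).ge⟩
  have c_eqOn {m n : ℕ} (hmn : m ≤ n) : EqOn (c n) (c m) (Iic (b + m * d)) := by
    induction n, hmn using Nat.le_induction with
    | base => exact fun _ _ => rfl
    | succ n hmn ih =>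
      have : Iic (b + m * d) ⊆ Iic (b + n * d) := Iic_subset_Iic.2 (by gcongr)
      exact ((next_eqOn _ _ (hc n)).mono this).trans ih
  let g : ℝ → α := fun t => c ⌈(t - b) / d⌉₊ t
  have g_eqOn (n : ℕ) : EqOn g (c n) (Iic (b + n * d)) := fun t ht => by
    refine (c_eqOn (Nat.ceil_le.2 ?_) ?_).symm
    · rw [div_le_iff₀ hd]; linarith [mem_Iic.1 ht]
    · have := Nat.le_ceil ((t - b) / d)
      rw [div_le_iff₀ hd] at this
      exact mem_Iic.2 (by linarith)
  refine ⟨g, by simpa [c] using g_eqOn 0, fun t ht => ?_⟩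
  let n := ⌊(t - b) / d⌋₊
  have hn : b + n * d ≤ t := by
    have := Nat.floor_le (div_nonneg (sub_nonneg.2 ht) hd.le)
    rw [le_div_iff₀ hd] at this
    linarith
  have hn' : t < b + (n + 1 : ℕ) * d := by
    have := Nat.lt_floor_add_one ((t - b) / d)
    rw [div_lt_iff₀ hd] at this
    push_cast; linarith
  refine congr (next_spec _ _ (hc n) t ⟨hn, (add_d n).symm ▸ hn'.le⟩) ?_
  filter_upwards [Iio_mem_nhds hn'] with s hs using (g_eqOn (n + 1) (mem_Iio.1 hs).le).symm

end Extension

section Geodesics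

variable {M : Type*} [TopologicalSpace M] {A : Set (OpenPartialHomeomorph M ℝ)}

/-- A family of real-valued charts covering `M` whose transition maps are local isometries of the
line; it is the datum of a Riemannian metric on a topological `1`-manifold. -/
structure IsometricAtlas (A : Set (OpenPartialHomeomorph M ℝ)) : Prop where
  exists_mem_source : ∀ x, ∃ σ ∈ A, x ∈ σ.source
  compatible : ∀ σ ∈ A, ∀ τ ∈ A, ∀ x ∈ σ.source, x ∈ τ.source →
    ∃ ε c : ℝ, |ε| = 1 ∧ ∀ᶠ y in 𝓝 x, τ y = ε * σ y + c

/-- Near the time `t`, the curve `γ` moves at unit speed in some chart of the family `A`. -/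
def IsGeodesicAt (A : Set (OpenPartialHomeomorph M ℝ)) (γ : ℝ → M) (t : ℝ) : Prop :=
  ∃ σ ∈ A, ∃ ε c : ℝ, |ε| = 1 ∧ ε * t + c ∈ σ.target ∧ γ =ᶠ[𝓝 t] fun s => σ.symm (ε * s + c)

namespace IsGeodesicAt

variable {γ η : ℝ → M} {t : ℝ}

theorem congr (h : IsGeodesicAt A γ t) (hη : γ =ᶠ[𝓝 t] η) : IsGeodesicAt A η t := by
  obtain ⟨σ, hσ, ε, c, hε, ht, hγ⟩ := h
  exact ⟨σ, hσ, ε, c, hε, ht, hη.symm.trans hγ⟩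

theorem comp_affine {δ b : ℝ} (hδ : |δ| = 1) (h : IsGeodesicAt A γ (δ * t + b)) :
    IsGeodesicAt A (fun s => γ (δ * s + b)) t := by
  obtain ⟨σ, hσ, ε, c, hε, ht, hγ⟩ := h
  have hcont : ContinuousAt (fun s : ℝ => δ * s + b) t := by fun_prop
  refine ⟨σ, hσ, ε * δ, ε * b + c, by rw [abs_mul, hε, hδ, one_mul],
    by convert ht using 1; ring, ?_⟩
  filter_upwards [hcont.eventually hγ] with s hs
  rw [hs]
  ring_nf

theorem continuousAt (h : IsGeodesicAt A γ t) : ContinuousAt γ t := by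
  obtain ⟨σ, -, ε, c, -, ht, hγ⟩ := h
  have hcont : ContinuousAt (fun s : ℝ => ε * s + c) t := by fun_prop
  exact ((σ.continuousAt_symm ht).comp (f := fun s : ℝ => ε * s + c) hcont).congr hγ.symm

theorem eventually_chart_eq (hA : IsometricAtlas A) (h : IsGeodesicAt A γ t)
    {τ : OpenPartialHomeomorph M ℝ} (hτ : τ ∈ A) (htτ : γ t ∈ τ.source) :
    ∃ ε c : ℝ, |ε| = 1 ∧ ∀ᶠ s in 𝓝 t, γ s ∈ τ.source ∧ τ (γ s) = ε * s + c := by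
  have hγt := h.continuousAt
  obtain ⟨σ, hσ, ε, c, hε, ht, hγ⟩ := h
  have hcont : ContinuousAt (fun s : ℝ => ε * s + c) t := by fun_prop
  have htσ : γ t ∈ σ.source := hγ.self_of_nhds ▸ σ.map_target ht
  obtain ⟨ε', c', hε', hτσ⟩ := hA.compatible σ hσ τ hτ _ htσ htτ
  refine ⟨ε' * ε, ε' * c + c', by rw [abs_mul, hε, hε', one_mul], ?_⟩
  filter_upwards [hγ, hcont.eventually (σ.open_target.mem_nhds ht), hγt.eventually hτσ,
    hγt.eventually (τ.open_source.mem_nhds htτ)] with s hs hsσ hsτ hsource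
  refine ⟨hsource, ?_⟩
  rw [hsτ, hs, σ.right_inv hsσ]
  ring

theorem eventuallyEq_of_frequently_eq [T2Space M] (hA : IsometricAtlas A)
    (hγ : IsGeodesicAt A γ t) (hη : IsGeodesicAt A η t) (h : ∃ᶠ s in 𝓝[≠] t, γ s = η s) :
    γ =ᶠ[𝓝 t] η := by
  have ht : γ t = η t := tendsto_nhds_unique_of_frequently_eq
    hγ.continuousAt.continuousWithinAt hη.continuousAt.continuousWithinAt h
  obtain ⟨τ, hτ, htτ⟩ := hA.exists_mem_source (γ t)
  obtain ⟨ε, c, -, hγτ⟩ := hγ.eventually_chart_eq hA hτ htτ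
  obtain ⟨δ, b, -, hητ⟩ := hη.eventually_chart_eq hA hτ (ht ▸ htτ)
  obtain ⟨s, hs, ⟨hsγ, hsη⟩, hst⟩ :=
    (h.and_eventually ((eventually_nhdsWithin_of_eventually_nhds (hγτ.and hητ)).and
      self_mem_nhdsWithin)).exists
  have eq_at_t : ε * t + c = δ * t + b := by
    rw [← hγτ.self_of_nhds.2, ← hητ.self_of_nhds.2, ht]
  have eq_at_s : ε * s + c = δ * s + b := by rw [← hsγ.2, ← hsη.2, hs]
  have hεδ : ε = δ :=
    mul_right_cancel₀ (sub_ne_zero.2 hst) (by linear_combination eq_at_s - eq_at_t)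
  filter_upwards [hγτ, hητ] with r hrγ hrη
  refine τ.injOn hrγ.1 hrη.1 ?_
  rw [hrγ.2, hrη.2]
  linear_combination (r - t) * hεδ + eq_at_t

end IsGeodesicAt

/-- A curve that moves at unit speed in the charts of `A` at all times. -/
def IsGeodesic (A : Set (OpenPartialHomeomorph M ℝ)) (γ : ℝ → M) : Prop :=
  ∀ t, IsGeodesicAt A γ t

namespace IsGeodesic

variable {γ η : ℝ → M}

theorem comp_affine (h : IsGeodesic A γ) {δ : ℝ} (hδ : |δ| = 1) (b : ℝ) :
    IsGeodesic A (fun s => γ (δ * s + b)) := fun _ => (h _).comp_affine hδ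

theorem isLocalHomeomorph (h : IsGeodesic A γ) : IsLocalHomeomorph γ := by
  refine IsLocalHomeomorph.mk γ fun t => ?_
  obtain ⟨σ, -, ε, c, hε, ht, hγ⟩ := h t
  have hε0 : ε ≠ 0 := abs_ne_zero.1 (hε ▸ one_ne_zero)
  obtain ⟨U, hUγ, hU, htU⟩ := eventually_nhds_iff.1 hγ
  let affine := (affineHomeomorph ε c hε0).toOpenPartialHomeomorph
  exact ⟨(affine.trans σ.symm).restrOpen U hU, ⟨⟨mem_univ t, ht⟩, htU⟩, fun s hs => hUγ s hs.2⟩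

theorem eq_of_eventuallyEq [T2Space M] (hA : IsometricAtlas A) (hγ : IsGeodesic A γ)
    (hη : IsGeodesic A η) {t : ℝ} (h : γ =ᶠ[𝓝 t] η) : γ = η := by
  have hclosed : IsClosed {t | γ =ᶠ[𝓝 t] η} := by
    refine isClosed_iff_derivedSet_subset _ |>.2 fun t ht => ?_
    refine (hγ t).eventuallyEq_of_frequently_eq hA (hη t) ?_
    exact (accPt_iff_frequently_nhdsNE.1 ht).mono fun s hs => hs.self_of_nhds
  have huniv := IsClopen.eq_univ ⟨hclosed, isOpen_setOfPred_eventually_nhds⟩ ⟨t, h⟩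
  funext s
  exact (huniv ▸ mem_univ s : s ∈ {t | γ =ᶠ[𝓝 t] η}).self_of_nhds

theorem exists_apply_add_eq [T2Space M] (hA : IsometricAtlas A) (hγ : IsGeodesic A γ)
    (hη : IsGeodesic A η) {a b : ℝ} (hab : γ a = η b) :
    ∃ δ : ℝ, |δ| = 1 ∧ ∀ s, γ (a + s) = η (b + δ * s) := by
  obtain ⟨τ, hτ, haτ⟩ := hA.exists_mem_source (γ a)
  obtain ⟨ε, c, hε, hγτ⟩ := (hγ a).eventually_chart_eq hA hτ haτ
  obtain ⟨ε', c', hε', hητ⟩ := (hη b).eventually_chart_eq hA hτ (hab ▸ haτ)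
  have hδ : |ε' * ε| = 1 := by rw [abs_mul, hε, hε', one_mul]
  have ε'_sq : ε' * ε' = 1 := by rw [← abs_mul_abs_self, hε', one_mul]
  have eq_at : ε * a + c = ε' * b + c' := by
    rw [← hγτ.self_of_nhds.2, ← hητ.self_of_nhds.2, hab]
  have hlim : Tendsto (fun s => ε' * ε * s + (b - ε' * ε * a)) (𝓝 a) (𝓝 b) :=
    Continuous.tendsto' (by fun_prop) _ _ (by ring)
  have hev : γ =ᶠ[𝓝 a] fun s => η (ε' * ε * s + (b - ε' * ε * a)) := by
    filter_upwards [hγτ, hlim.eventually hητ] with s hsγ hsη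
    refine τ.injOn hsγ.1 hsη.1 ?_
    rw [hsγ.2, hsη.2]
    linear_combination eq_at - ε * (s - a) * ε'_sq
  refine ⟨ε' * ε, hδ, fun s => ?_⟩
  rw [hγ.eq_of_eventuallyEq hA (hη.comp_affine hδ _) hev]
  ring_nf

theorem range_subset_of_not_disjoint [T2Space M] (hA : IsometricAtlas A) (hγ : IsGeodesic A γ)
    (hη : IsGeodesic A η) (h : ¬ Disjoint (range γ) (range η)) : range γ ⊆ range η := by
  obtain ⟨_, ⟨a, rfl⟩, ⟨b, hb⟩⟩ := not_disjoint_iff.1 h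
  obtain ⟨δ, -, hδ⟩ := hγ.exists_apply_add_eq hA hη hb.symm
  rintro _ ⟨s, rfl⟩
  exact ⟨b + δ * (s - a), by rw [← hδ, add_sub_cancel]⟩

theorem periodic_of_apply_eq [T2Space M] (hA : IsometricAtlas A) (h : IsGeodesic A γ)
    {a b : ℝ} (hab : γ a = γ b) : Function.Periodic γ (b - a) := by
  obtain ⟨δ, hδ, hs⟩ := h.exists_apply_add_eq hA h hab
  obtain rfl | rfl := (abs_eq zero_le_one).1 hδ
  · intro t
    simpa [add_comm, add_sub_assoc, add_sub_left_comm] using (hs (t - a)).symm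
  -- Otherwise `γ` is symmetric about the midpoint of `a` and `b`, so it is not injective there.
  · exfalso
    obtain ⟨U, hU, hmU, hinj⟩ := (h.isLocalHomeomorph.isLocallyInjective) ((a + b) / 2)
    obtain ⟨r, hr, hball⟩ := Metric.isOpen_iff.1 hU _ hmU
    have hmem (s : ℝ) (hs : |s| < r) : (a + b) / 2 + s ∈ U :=
      hball (by rwa [Metric.mem_ball, Real.dist_eq, add_sub_cancel_left])
    have := hinj (hmem (r / 2) (by rw [abs_of_pos] <;> linarith))
      (hmem (-(r / 2)) (by rw [abs_neg, abs_of_pos] <;> linarith))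
      (by convert hs ((b - a) / 2 + r / 2) using 2 <;> ring)
    linarith

end IsGeodesic

namespace IsometricAtlas

theorem exists_uniform_radius [CompactSpace M] (hA : IsometricAtlas A) :
    ∃ δ > 0, ∀ x : M, ∃ σ ∈ A, x ∈ σ.source ∧ Metric.ball (σ x) δ ⊆ σ.target := by
  suffices ∃ δ > 0, ∀ x ∈ (univ : Set M), ∃ σ ∈ A, x ∈ σ.source ∧ Metric.ball (σ x) δ ⊆ σ.target by
    simpa using this
  refine isCompact_univ.induction_on (p := fun K => ∃ δ > 0, ∀ x ∈ K, ∃ σ ∈ A,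
    x ∈ σ.source ∧ Metric.ball (σ x) δ ⊆ σ.target) ⟨1, one_pos, by simp⟩ ?_ ?_ fun x _ => ?_
  · rintro K L hKL ⟨δ, hδ, hL⟩
    exact ⟨δ, hδ, fun x hx => hL x (hKL hx)⟩
  · rintro K L ⟨δ, hδ, hK⟩ ⟨δ', hδ', hL⟩
    refine ⟨min δ δ', lt_min hδ hδ', ?_⟩
    rintro x (hx | hx)
    · obtain ⟨σ, hσ, hxσ, hball⟩ := hK x hx
      exact ⟨σ, hσ, hxσ, (Metric.ball_subset_ball (min_le_left _ _)).trans hball⟩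
    · obtain ⟨σ, hσ, hxσ, hball⟩ := hL x hx
      exact ⟨σ, hσ, hxσ, (Metric.ball_subset_ball (min_le_right _ _)).trans hball⟩
  · obtain ⟨σ, hσ, hxσ⟩ := hA.exists_mem_source x
    obtain ⟨r, hr, hball⟩ := Metric.isOpen_iff.1 σ.open_target _ (σ.map_source hxσ)
    refine ⟨_, mem_nhdsWithin_of_mem_nhds ((σ.isOpen_inter_preimage
      Metric.isOpen_ball).mem_nhds ⟨hxσ, Metric.mem_ball_self (half_pos hr)⟩), r / 2, half_pos hr,
      fun y hy => ⟨σ, hσ, hy.1, (Metric.ball_subset_ball' ?_).trans hball⟩⟩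
    have := Metric.mem_ball.1 hy.2
    linarith

theorem exists_extension_right (hA : IsometricAtlas A) {δ : ℝ}
    (hball : ∀ x : M, ∃ σ ∈ A, x ∈ σ.source ∧ Metric.ball (σ x) δ ⊆ σ.target)
    {γ : ℝ → M} {b : ℝ} (h : IsGeodesicAt A γ b) :
    ∃ η : ℝ → M, EqOn η γ (Iic b) ∧ ∀ t ∈ Ico b (b + δ), IsGeodesicAt A η t := by
  obtain ⟨σ, hσ, hbσ, hsub⟩ := hball (γ b)
  obtain ⟨ε, c, hε, hγσ⟩ := h.eventually_chart_eq hA hσ hbσ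
  have hball_target (t : ℝ) (ht : t ∈ Ico b (b + δ)) : ε * t + c ∈ σ.target := by
    refine hsub ?_
    rw [hγσ.self_of_nhds.2, Metric.mem_ball, Real.dist_eq,
      show ε * t + c - (ε * b + c) = ε * (t - b) by ring, abs_mul, hε, one_mul,
      abs_of_nonneg (sub_nonneg.2 ht.1)]
    linarith [ht.2]
  let η : ℝ → M := fun s => if s ≤ b then γ s else σ.symm (ε * s + c)
  refine ⟨η, fun s hs => if_pos hs, fun t ht => ?_⟩
  obtain rfl | hbt := ht.1.eq_or_lt
  · refine h.congr ?_
    filter_upwards [hγσ] with s hs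
    simp only [η, ← hs.2, σ.left_inv hs.1, ite_self]
  · refine ⟨σ, hσ, ε, c, hε, hball_target t ht, ?_⟩
    filter_upwards [Ioi_mem_nhds hbt] with s hs using if_neg (not_le.2 hs)

theorem exists_isGeodesic [CompactSpace M] (hA : IsometricAtlas A) (x : M) :
    ∃ γ : ℝ → M, IsGeodesic A γ ∧ γ 0 = x := by
  obtain ⟨δ, hδ, hball⟩ := hA.exists_uniform_radius
  have extend {γ : ℝ → M} {b : ℝ} (h : IsGeodesicAt A γ b) :
      ∃ η, EqOn η γ (Iic b) ∧ ∀ t, b ≤ t → IsGeodesicAt A η t := by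
    refine exists_eqOn_Iic_forall_ge IsGeodesicAt.congr (half_pos hδ) (fun γ b h => ?_) h
    obtain ⟨η, hηγ, hη⟩ := hA.exists_extension_right hball h
    exact ⟨η, hηγ, fun t ht => hη t ⟨ht.1, by linarith [ht.2]⟩⟩
  obtain ⟨σ, hσ, hxσ⟩ := hA.exists_mem_source x
  have hgerm : IsGeodesicAt A (fun s => σ.symm (1 * s + σ x)) 0 :=
    ⟨σ, hσ, 1, σ x, abs_one, by simpa using σ.map_source hxσ, .rfl⟩
  obtain ⟨η, hη_eq, hη⟩ := extend hgerm
  have hη_reverse (t : ℝ) (ht : t ≤ 0) : IsGeodesicAt A (fun s => η (-1 * s + 0)) t :=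
    (hη _ (by linarith)).comp_affine (by simp)
  obtain ⟨γ, hγ_eq, hγ⟩ := extend (hη_reverse 0 le_rfl)
  refine ⟨γ, fun t => ?_, ?_⟩
  · obtain ht | ht := le_or_gt 0 t
    · exact hγ t ht
    · refine (hη_reverse t ht.le).congr ?_
      filter_upwards [Iio_mem_nhds ht] with s hs using (hγ_eq (mem_Iio.1 hs).le).symm
  · rw [hγ_eq self_mem_Iic]
    simpa [σ.left_inv hxσ] using hη_eq self_mem_Iic

end IsometricAtlas

namespace IsGeodesic

variable {γ : ℝ → M}

theorem isClosed_range [T2Space M] [CompactSpace M] (hA : IsometricAtlas A)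
    (h : IsGeodesic A γ) : IsClosed (range γ) := by
  refine isOpen_compl_iff.1 (isOpen_iff_mem_nhds.2 fun x hx => ?_)
  obtain ⟨η, hη, rfl⟩ := hA.exists_isGeodesic x
  filter_upwards [hη.isLocalHomeomorph.isOpenMap.isOpen_range.mem_nhds (mem_range_self 0)]
    with y hy hyγ
  exact hx (hη.range_subset_of_not_disjoint hA h (not_disjoint_iff.2 ⟨y, hy, hyγ⟩)
    (mem_range_self 0))

theorem range_eq_connectedComponent [T2Space M] [CompactSpace M] (hA : IsometricAtlas A)
    (h : IsGeodesic A γ) (t : ℝ) : range γ = connectedComponent (γ t) := by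
  refine Subset.antisymm ?_ ?_
  · exact (isPreconnected_range h.isLocalHomeomorph.continuous).subset_connectedComponent
      (mem_range_self t)
  · have hclopen : IsClopen (range γ) :=
      ⟨h.isClosed_range hA, h.isLocalHomeomorph.isOpenMap.isOpen_range⟩
    exact hclopen.connectedComponent_subset (mem_range_self t)

theorem not_injective [T2Space M] [CompactSpace M] (hA : IsometricAtlas A)
    (h : IsGeodesic A γ) : ¬ Function.Injective γ := fun hinj => by
  have hopen : IsOpenEmbedding γ := h.isLocalHomeomorph.isOpenEmbedding_of_injective hinj
  have hclosed : IsClosedEmbedding γ := ⟨hopen.isEmbedding, h.isClosed_range hA⟩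
  exact not_compactSpace_iff.2 inferInstance hclosed.compactSpace

theorem exists_period [T2Space M] [CompactSpace M] (hA : IsometricAtlas A) (h : IsGeodesic A γ) :
    ∃ T ≠ 0, ∀ a b, γ a = γ b ↔ b - a ∈ AddSubgroup.zmultiples T := by
  let P : AddSubgroup ℝ :=
    { carrier := {c | Function.Periodic γ c}
      zero_mem' := fun t => by rw [add_zero]
      add_mem' := fun h1 h2 => h1.add_period h2
      neg_mem' := fun h1 => h1.neg }
  have apply_eq_iff (a b : ℝ) : γ a = γ b ↔ b - a ∈ P :=
    ⟨h.periodic_of_apply_eq hA, fun hc => by simpa using (hc a).symm⟩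
  obtain ⟨U, hU, h0U, hinj⟩ := h.isLocalHomeomorph.isLocallyInjective 0
  obtain ⟨r, hr, hball⟩ := Metric.isOpen_iff.1 hU _ h0U
  have hdisj : Disjoint (P : Set ℝ) (Ioo 0 r) := by
    refine disjoint_left.2 fun c hc hcr => hcr.1.ne ?_
    refine hinj h0U (hball ?_) ((apply_eq_iff 0 c).2 (by rwa [sub_zero]))
    rw [mem_ball_zero_iff, Real.norm_of_nonneg hcr.1.le]
    exact hcr.2
  obtain ⟨T, hT⟩ := AddSubgroup.cyclic_of_isolated_zero hr hdisj
  rw [← AddSubgroup.zmultiples_eq_closure] at hT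
  refine ⟨T, ?_, fun a b => hT ▸ apply_eq_iff a b⟩
  rintro rfl
  refine h.not_injective hA fun a b hab => ?_
  have : b - a ∈ P := (apply_eq_iff a b).1 hab
  rw [hT, AddSubgroup.zmultiples_zero_eq_bot, AddSubgroup.mem_bot, sub_eq_zero] at this
  exact this.symm

end IsGeodesic

end Geodesics

section Calculus

theorem exists_eventually_eq_affine_of_abs_deriv_eq_one {h : ℝ → ℝ} {x : ℝ}
    (hh : ContDiffAt ℝ 1 h x) (hd : ∀ᶠ y in 𝓝 x, |deriv h y| = 1) :
    ∃ ε c : ℝ, |ε| = 1 ∧ ∀ᶠ y in 𝓝 x, h y = ε * y + c := by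
  have hdx : |deriv h x| = 1 := hd.self_of_nhds
  have hcont : ContinuousAt (deriv h) x :=
    ContDiffAt.continuousAt (n := 0) (hh.derivWithin (by norm_num))
  have hconst : ∀ᶠ y in 𝓝 x, deriv h y = deriv h x := by
    filter_upwards [hd, Metric.tendsto_nhds.1 hcont 1 one_pos] with y hy hdist
    rw [Real.dist_eq, abs_lt] at hdist
    rcases (abs_eq zero_le_one).1 hy with h1 | h1 <;>
    rcases (abs_eq zero_le_one).1 hdx with h2 | h2 <;> rw [h1, h2] at hdist ⊢ <;> linarith
  have hdiff : ∀ᶠ y in 𝓝 x, DifferentiableAt ℝ h y :=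
    (hh.eventually (by simp)).mono fun y hy => hy.differentiableAt (by norm_num)
  obtain ⟨r, hr, hball⟩ := Metric.eventually_nhds_iff_ball.1 (hconst.and hdiff)
  refine ⟨deriv h x, h x - deriv h x * x, hdx, eventually_of_mem (Metric.ball_mem_nhds x hr) ?_⟩
  refine Metric.isOpen_ball.eqOn_of_deriv_eq (convex_ball x r).isPreconnected
    (fun y hy => (hball y hy).2.differentiableWithinAt) (by fun_prop) (fun y hy => ?_)
    (Metric.mem_ball_self hr) (by ring)
  simp [(hball y hy).1]

theorem exists_contDiffOn_hasDerivAt_ball {v : ℝ → ℝ} {x r : ℝ}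
    (hv : ContDiffOn ℝ ∞ v (Metric.ball x r)) :
    ∃ a : ℝ → ℝ, ContDiffOn ℝ ∞ a (Metric.ball x r) ∧
      ∀ t ∈ Metric.ball x r, HasDerivAt a (v t) t := by
  have hcont : ContinuousOn v (Metric.ball x r) := hv.continuousOn
  have hderiv : ∀ t ∈ Metric.ball x r, HasDerivAt (fun t => ∫ y in x..t, v y) (v t) t :=
    fun t ht => by
      have hx : x ∈ Metric.ball x r := Metric.mem_ball_self (Metric.pos_of_mem_ball ht)
      have hsub : uIcc x t ⊆ Metric.ball x r :=
        (convex_ball x r).ordConnected.uIcc_subset hx ht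
      exact intervalIntegral.integral_hasDerivAt_right (hcont.mono hsub).intervalIntegrable
        (hcont.stronglyMeasurableAtFilter Metric.isOpen_ball t ht)
        (hcont.continuousAt (Metric.isOpen_ball.mem_nhds ht))
  refine ⟨_, ?_, hderiv⟩
  rw [contDiffOn_infty_iff_deriv_of_isOpen Metric.isOpen_ball]
  exact ⟨fun t ht => (hderiv t ht).differentiableAt.differentiableWithinAt,
    hv.congr fun t ht => (hderiv t ht).deriv⟩

theorem exists_openPartialHomeomorph_of_hasDerivAt_ne_zero {a v : ℝ → ℝ} {s : Set ℝ} (hs : IsOpen s)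
    (ha : ContDiffOn ℝ ∞ a s) (hderiv : ∀ t ∈ s, HasDerivAt a (v t) t) (hv : ∀ t ∈ s, v t ≠ 0)
    {x : ℝ} (hx : x ∈ s) :
    ∃ B : OpenPartialHomeomorph ℝ ℝ, ⇑B = a ∧ x ∈ B.source ∧ B.source ⊆ s ∧
      ContDiffOn ℝ ∞ B.symm B.target := by
  have hat (t : ℝ) (ht : t ∈ s) : ContDiffAt ℝ ∞ a t := ha.contDiffAt (hs.mem_nhds ht)
  have hstrict := ((hat x hx).hasStrictDerivAt' (hderiv x hx) (by simp)).hasStrictFDerivAt_equiv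
    (hv x hx)
  refine ⟨(hstrict.toOpenPartialHomeomorph a).restrOpen s hs, rfl,
    ⟨hstrict.mem_toOpenPartialHomeomorph_source, hx⟩, fun t ht => ht.2, fun t ht => ?_⟩
  have hts := (((hstrict.toOpenPartialHomeomorph a).restrOpen s hs).map_target ht).2
  exact (OpenPartialHomeomorph.contDiffAt_symm_deriv _ (hv _ hts) ht (hderiv _ hts)
    (hat _ hts)).contDiffWithinAt

end Calculus

section UnitSpeed

variable {E H F M : Type*} [NormedAddCommGroup E] [NormedSpace ℝ E] [TopologicalSpace H]
  {I : ModelWithCorners ℝ E H} [TopologicalSpace M] [ChartedSpace H M]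
  [NormedAddCommGroup F] [NormedSpace ℝ F] {e : M → F} {σ τ : OpenPartialHomeomorph M ℝ}

variable (I) in
/-- A real-valued chart of `M` that is a diffeomorphism onto its image for the smooth structure
given by the model `I`. -/
structure IsSmoothRealChart (σ : OpenPartialHomeomorph M ℝ) : Prop where
  contMDiffOn : ContMDiffOn I 𝓘(ℝ, ℝ) ∞ σ σ.source
  contMDiffOn_symm : ContMDiffOn 𝓘(ℝ, ℝ) I ∞ σ.symm σ.target

variable (I) in
/-- A smooth real chart whose inverse is parametrized by arc length with respect to the map `e` to
a normed space. -/
structure IsUnitSpeedChart (e : M → F) (σ : OpenPartialHomeomorph M ℝ) : Prop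
    extends IsSmoothRealChart I σ where
  norm_deriv : ∀ t ∈ σ.target, ‖deriv (e ∘ σ.symm) t‖ = 1

namespace IsSmoothRealChart

theorem contDiffAt_comp_symm (hσ : IsSmoothRealChart I σ) (he : ContMDiff I 𝓘(ℝ, F) ∞ e) {t : ℝ}
    (ht : t ∈ σ.target) : ContDiffAt ℝ ∞ (e ∘ σ.symm) t :=
  contMDiffAt_iff_contDiffAt.1
    ((he _).comp t (hσ.contMDiffOn_symm.contMDiffAt (σ.open_target.mem_nhds ht)))

theorem contDiffAt_transition (hσ : IsSmoothRealChart I σ) (hτ : IsSmoothRealChart I τ) {t : ℝ}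
    (ht : t ∈ σ.target) (htτ : σ.symm t ∈ τ.source) : ContDiffAt ℝ ∞ (τ ∘ σ.symm) t :=
  contMDiffAt_iff_contDiffAt.1 ((hτ.contMDiffOn.contMDiffAt (τ.open_source.mem_nhds htτ)).comp t
    (hσ.contMDiffOn_symm.contMDiffAt (σ.open_target.mem_nhds ht)))

theorem deriv_comp_symm_ne_zero (hσ : IsSmoothRealChart I σ) (he : ContMDiff I 𝓘(ℝ, F) ∞ e)
    {t : ℝ} (ht : t ∈ σ.target) (hinj : Function.Injective (mfderiv I 𝓘(ℝ, F) e (σ.symm t))) :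
    deriv (e ∘ σ.symm) t ≠ 0 := fun h0 => by
  have hσ' : σ.MDifferentiable I 𝓘(ℝ, ℝ) :=
    ⟨hσ.contMDiffOn.mdifferentiableOn (by simp), hσ.contMDiffOn_symm.mdifferentiableOn (by simp)⟩
  have hcomp : Function.Injective (mfderiv 𝓘(ℝ, ℝ) 𝓘(ℝ, F) (e ∘ σ.symm) t) := by
    rw [mfderiv_comp t ((he _).mdifferentiableAt (by simp)) (hσ'.mdifferentiableAt_symm ht)]
    exact hinj.comp (hσ'.symm.mfderiv_injective ht)
  rw [mfderiv_eq_fderiv] at hcomp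
  have hone : (1 : ℝ) = 0 := hcomp (h0.trans (map_zero _).symm)
  exact one_ne_zero hone

theorem exists_isUnitSpeedChart {F : Type*} [NormedAddCommGroup F] [InnerProductSpace ℝ F]
    {e : M → F} (hσ : IsSmoothRealChart I σ) (he : ContMDiff I 𝓘(ℝ, F) ∞ e)
    (hinj : ∀ x, Function.Injective (mfderiv I 𝓘(ℝ, F) e x)) {x : M} (hx : x ∈ σ.source) :
    ∃ τ, IsUnitSpeedChart I e τ ∧ x ∈ τ.source := by
  obtain ⟨r, hr, hball⟩ := Metric.isOpen_iff.1 σ.open_target _ (σ.map_source hx)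
  let v : ℝ → ℝ := fun t => ‖deriv (e ∘ σ.symm) t‖
  have hc (t : ℝ) (ht : t ∈ σ.target) : ContDiffAt ℝ ∞ (e ∘ σ.symm) t :=
    hσ.contDiffAt_comp_symm he ht
  have hc' (t : ℝ) (ht : t ∈ σ.target) : deriv (e ∘ σ.symm) t ≠ 0 :=
    hσ.deriv_comp_symm_ne_zero he ht (hinj _)
  have hv : ContDiffOn ℝ ∞ v (Metric.ball (σ x) r) := fun t ht => by
    have : ContDiffAt ℝ ∞ (deriv (e ∘ σ.symm)) t := (hc t (hball ht)).derivWithin (by simp)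
    exact (this.norm ℝ (hc' t (hball ht))).contDiffWithinAt
  -- The antiderivative of the speed is the arc length.
  obtain ⟨a, ha, hav⟩ := exists_contDiffOn_hasDerivAt_ball hv
  obtain ⟨B, rfl, hxB, hBball, hB⟩ := exists_openPartialHomeomorph_of_hasDerivAt_ne_zero
    Metric.isOpen_ball ha hav (fun t ht => norm_ne_zero_iff.2 (hc' t (hball ht)))
    (Metric.mem_ball_self hr)
  refine ⟨σ.trans B, ⟨⟨?_, ?_⟩, fun t ht => ?_⟩, ⟨hx, hxB⟩⟩
  · exact (ha.mono hBball).contMDiffOn.comp (hσ.contMDiffOn.mono fun y hy => hy.1) fun y hy => hy.2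
  · exact hσ.contMDiffOn_symm.comp (hB.contMDiffOn.mono fun y hy => hy.1) fun y hy => hy.2
  · have hbB := B.map_target ht.1
    have hb : B.symm t ∈ σ.target := hball (hBball hbB)
    have hspeed : v (B.symm t) ≠ 0 := norm_ne_zero_iff.2 (hc' _ hb)
    have hderiv := ((hc _ hb).differentiableAt (by simp)).hasDerivAt.scomp t
      (B.hasDerivAt_symm ht.1 hspeed (hav _ (hBball hbB)))
    change ‖deriv ((e ∘ σ.symm) ∘ B.symm) t‖ = 1
    rw [hderiv.deriv, norm_smul, norm_inv, norm_norm, inv_mul_cancel₀ hspeed]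

end IsSmoothRealChart

namespace IsUnitSpeedChart

theorem abs_deriv_transition (hσ : IsUnitSpeedChart I e σ) (hτ : IsUnitSpeedChart I e τ)
    (he : ContMDiff I 𝓘(ℝ, F) ∞ e) {t : ℝ} (ht : t ∈ σ.target) (htτ : σ.symm t ∈ τ.source) :
    |deriv (τ ∘ σ.symm) t| = 1 := by
  have hmem : ∀ᶠ s in 𝓝 t, σ.symm s ∈ τ.source :=
    (σ.continuousAt_symm ht).eventually (τ.open_source.mem_nhds htτ)
  have hfactor : e ∘ σ.symm =ᶠ[𝓝 t] (e ∘ τ.symm) ∘ (τ ∘ σ.symm) := by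
    filter_upwards [hmem] with s hs
    simp [τ.left_inv hs]
  have htrans : DifferentiableAt ℝ (τ ∘ σ.symm) t :=
    (hσ.contDiffAt_transition hτ.toIsSmoothRealChart ht htτ).differentiableAt (by simp)
  have hcurve : DifferentiableAt ℝ (e ∘ τ.symm) (τ (σ.symm t)) :=
    (hτ.contDiffAt_comp_symm he (τ.map_source htτ)).differentiableAt (by simp)
  have hchain := hcurve.hasDerivAt.scomp (h := τ ∘ σ.symm) t htrans.hasDerivAt
  have hspeed := hσ.norm_deriv t ht
  rwa [hfactor.deriv_eq, hchain.deriv, norm_smul, hτ.norm_deriv _ (τ.map_source htτ), mul_one]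
    at hspeed

theorem exists_eventually_eq_affine (hσ : IsUnitSpeedChart I e σ) (hτ : IsUnitSpeedChart I e τ)
    (he : ContMDiff I 𝓘(ℝ, F) ∞ e) {x : M} (hxσ : x ∈ σ.source) (hxτ : x ∈ τ.source) :
    ∃ ε c : ℝ, |ε| = 1 ∧ ∀ᶠ y in 𝓝 x, τ y = ε * σ y + c := by
  have hx := σ.map_source hxσ
  rw [← σ.left_inv hxσ] at hxτ
  obtain ⟨ε, c, hε, haffine⟩ := exists_eventually_eq_affine_of_abs_deriv_eq_one
    (x := σ x) ((hσ.contDiffAt_transition hτ.toIsSmoothRealChart hx hxτ).of_le (by simp)) <| by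
      filter_upwards [σ.open_target.mem_nhds hx,
        (σ.continuousAt_symm hx).eventually (τ.open_source.mem_nhds hxτ)] with t ht htτ
      exact hσ.abs_deriv_transition hτ he ht htτ
  refine ⟨ε, c, hε, ?_⟩
  filter_upwards [(σ.continuousAt hxσ).eventually haffine, σ.open_source.mem_nhds hxσ] with y hy hyσ
  rwa [Function.comp_apply, σ.left_inv hyσ] at hy

end IsUnitSpeedChart

theorem isSmoothRealChart_chartAt_transHomeomorph {M : Type*} [TopologicalSpace M]
    [ChartedSpace E M] [IsManifold 𝓘(ℝ, E) ∞ M] (L : E ≃L[ℝ] ℝ) (x : M) :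
    IsSmoothRealChart 𝓘(ℝ, E) ((chartAt E x).transHomeomorph L.toHomeomorph) where
  contMDiffOn := L.contDiff.contMDiff.comp_contMDiffOn contMDiffOn_chart
  contMDiffOn_symm := contMDiffOn_chart_symm.comp
    (L.symm.contDiff (n := ∞)).contMDiff.contMDiffOn fun _ ht => ht

theorem isometricAtlas_isUnitSpeedChart {F M : Type*} [TopologicalSpace M] [ChartedSpace E M]
    [IsManifold 𝓘(ℝ, E) ∞ M] (L : E ≃L[ℝ] ℝ) [NormedAddCommGroup F] [InnerProductSpace ℝ F]
    {e : M → F} (he : ContMDiff 𝓘(ℝ, E) 𝓘(ℝ, F) ∞ e)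
    (hinj : ∀ x, Function.Injective (mfderiv 𝓘(ℝ, E) 𝓘(ℝ, F) e x)) :
    IsometricAtlas {σ | IsUnitSpeedChart 𝓘(ℝ, E) e σ} where
  exists_mem_source x :=
    (isSmoothRealChart_chartAt_transHomeomorph L x).exists_isUnitSpeedChart he hinj
      (mem_chart_source E x)
  compatible _ hσ _ hτ _ hxσ hxτ := hσ.exists_eventually_eq_affine hτ he hxσ hxτ

theorem IsGeodesic.isLocalDiffeomorph {A : Set (OpenPartialHomeomorph M ℝ)}
    (hA : ∀ σ ∈ A, IsSmoothRealChart I σ) {γ : ℝ → M} (h : IsGeodesic A γ) :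
    IsLocalDiffeomorph 𝓘(ℝ, ℝ) I ∞ γ := fun t => by
  obtain ⟨σ, hσA, ε, c, hε, ht, hγ⟩ := h t
  have hσ := hA σ hσA
  have hε0 : ε ≠ 0 := abs_ne_zero.1 (hε ▸ one_ne_zero)
  obtain ⟨U, hUγ, hU, htU⟩ := eventually_nhds_iff.1 hγ
  let affine := (affineHomeomorph ε c hε0).toOpenPartialHomeomorph
  let Φ := (affine.restrOpen U hU).trans σ.symm
  have hto : ContDiff ℝ ∞ affine := contDiff_const.mul contDiff_id |>.add contDiff_const
  have hinv : ContDiff ℝ ∞ affine.symm := (contDiff_id.sub contDiff_const).div_const ε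
  exact ⟨{ Φ with
    contMDiffOn_toFun := hσ.contMDiffOn_symm.comp hto.contMDiff.contMDiffOn fun s hs => hs.2
    contMDiffOn_invFun := hinv.contMDiff.comp_contMDiffOn (hσ.contMDiffOn.mono fun y hy => hy.1) },
    ⟨⟨mem_univ t, htU⟩, ht⟩, fun s hs => hUγ s hs.1.2⟩

end UnitSpeed

section LocalDiffeomorph

variable {𝕜 : Type*} [NontriviallyNormedField 𝕜] {E E' E'' : Type*} [NormedAddCommGroup E]
  [NormedSpace 𝕜 E] [NormedAddCommGroup E'] [NormedSpace 𝕜 E'] [NormedAddCommGroup E'']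
  [NormedSpace 𝕜 E''] {H H' H'' : Type*} [TopologicalSpace H] [TopologicalSpace H']
  [TopologicalSpace H''] {I : ModelWithCorners 𝕜 E H} {I' : ModelWithCorners 𝕜 E' H'}
  {I'' : ModelWithCorners 𝕜 E'' H''} {L M S : Type*} [TopologicalSpace L] [ChartedSpace H L]
  [TopologicalSpace M] [ChartedSpace H' M] [TopologicalSpace S] [ChartedSpace H'' S] {n : ℕ∞ω}

theorem isLocalDiffeomorphAt_congr {f g : M → S} {x : M} (hf : IsLocalDiffeomorphAt I' I'' n f x)
    (hfg : f =ᶠ[𝓝 x] g) : IsLocalDiffeomorphAt I' I'' n g x := by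
  obtain ⟨Φ, hx, hΦ⟩ := hf
  obtain ⟨U, hU, hUopen, hxU⟩ := eventually_nhds_iff.1 hfg
  exact ⟨{ Φ.toOpenPartialHomeomorph.restrOpen U hUopen with
    contMDiffOn_toFun := Φ.contMDiffOn_toFun.mono inter_subset_left
    contMDiffOn_invFun := Φ.contMDiffOn_invFun.mono inter_subset_left },
    ⟨hx, hxU⟩, fun y hy => (hU y hy.2).symm.trans (hΦ hy.1)⟩

theorem isLocalDiffeomorphAt_of_comp {f : L → M} {F : M → S} {a : L}
    (hf : IsLocalDiffeomorphAt I I' n f a) (hF : IsLocalDiffeomorphAt I I'' n (F ∘ f) a) :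
    IsLocalDiffeomorphAt I' I'' n F (f a) := by
  have hinv : hf.localInverse (f a) = a := hf.localInverse_left_inv hf.localInverse_mem_target
  refine isLocalDiffeomorphAt_congr (f := (F ∘ f) ∘ hf.localInverse)
    (hf.localInverse_isLocalDiffeomorphAt.comp _ _ (by rwa [hinv])) ?_
  filter_upwards [hf.localInverse_eventuallyEq_right] with y hy
  exact congrArg F hy

theorem isLocalDiffeomorph_opens_val [IsManifold I' n M] (U : TopologicalSpace.Opens M) :
    IsLocalDiffeomorph I' I' n (Subtype.val : U → M) := fun x => by
  let φ := U.openPartialHomeomorphSubtypeCoe ⟨x⟩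
  refine ⟨{ φ with
    contMDiffOn_toFun := (contMDiff_subtype_val (I := I')).contMDiffOn
    contMDiffOn_invFun := fun y hy => ContMDiffAt.contMDiffWithinAt ?_ },
    mem_univ x, fun _ _ => rfl⟩
  have hyU : y ∈ U := by simpa [φ] using hy
  refine (contMDiffAt_subtype_iff (U := U) (x := ⟨y, hyU⟩)).1 ?_
  have hid : (fun z : U => φ.symm z) = id := funext fun z => φ.left_inv (mem_univ z)
  exact hid ▸ contMDiffAt_id

end LocalDiffeomorph

section Classification

variable {E H M : Type*} [NormedAddCommGroup E] [NormedSpace ℝ E] [TopologicalSpace H]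
  {I : ModelWithCorners ℝ E H} [TopologicalSpace M] [ChartedSpace H M] {γ : ℝ → M}

variable (I) in
/-- A local diffeomorphism from the line whose fibres are the cosets of `ℤ`: its image is a smooth
circle in `M`. -/
structure IsPeriodicParametrization (γ : ℝ → M) : Prop where
  isLocalDiffeomorph : IsLocalDiffeomorph 𝓘(ℝ, ℝ) I ∞ γ
  apply_eq_iff : ∀ a b, γ a = γ b ↔ b - a ∈ AddSubgroup.zmultiples (1 : ℝ)

theorem isPeriodicParametrization_comp_mul {T : ℝ} (hT : T ≠ 0)
    (hγ : IsLocalDiffeomorph 𝓘(ℝ, ℝ) I ∞ γ)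
    (hper : ∀ a b, γ a = γ b ↔ b - a ∈ AddSubgroup.zmultiples T) :
    IsPeriodicParametrization I fun t => γ (t * T) where
  isLocalDiffeomorph t :=
    ((ContinuousLinearEquiv.unitsEquivAut ℝ (Units.mk0 T hT)).toDiffeomorph.isLocalDiffeomorph
      t).comp I M (hγ (t * T))
  apply_eq_iff a b := by
    simp only [hper, ← sub_mul, AddSubgroup.mem_zmultiples_iff, zsmul_eq_mul, mul_one,
      mul_left_inj' hT]

theorem exists_isPeriodicParametrization {M : Type*} [TopologicalSpace M] [T2Space M]
    [CompactSpace M] [ChartedSpace E M] [IsManifold 𝓘(ℝ, E) ∞ M] (L : E ≃L[ℝ] ℝ)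
    (c : ConnectedComponents M) :
    ∃ γ : ℝ → M, IsPeriodicParametrization 𝓘(ℝ, E) γ ∧
      range γ = ConnectedComponents.mk ⁻¹' {c} := by
  have : FiniteDimensional ℝ E := L.symm.toLinearEquiv.finiteDimensional
  obtain ⟨x, rfl⟩ := ConnectedComponents.surjective_coe c
  obtain ⟨_, e, he, -, hinj⟩ := exists_embedding_euclidean_of_compact (I := 𝓘(ℝ, E)) (M := M)
  have hA := isometricAtlas_isUnitSpeedChart L he hinj
  obtain ⟨γ, hγ, rfl⟩ := hA.exists_isGeodesic x
  obtain ⟨T, hT, hper⟩ := hγ.exists_period hA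
  refine ⟨_, isPeriodicParametrization_comp_mul hT
    (hγ.isLocalDiffeomorph fun σ hσ => hσ.toIsSmoothRealChart) hper, ?_⟩
  rw [connectedComponents_preimage_singleton, ← hγ.range_eq_connectedComponent hA 0]
  exact (mul_right_surjective₀ hT).range_comp γ

/-- The line as a linear model of `ℝ¹`. -/
noncomputable def euclideanOneEquiv : EuclideanSpace ℝ (Fin 1) ≃L[ℝ] ℝ :=
  (EuclideanSpace.equiv (Fin 1) ℝ).trans (ContinuousLinearEquiv.funUnique (Fin 1) ℝ ℝ)

instance : PreconnectedSpace UnitCircle :=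
  Subtype.preconnectedSpace (isPreconnected_sphere (by
    rw [← Module.finrank_eq_rank, finrank_euclideanSpace_fin]; norm_num) _ _)

theorem exists_surjective_isPeriodicParametrization_unitCircle :
    ∃ q : ℝ → UnitCircle, IsPeriodicParametrization (𝓡 1) q ∧ Function.Surjective q := by
  obtain ⟨q, hq, hrange⟩ := exists_isPeriodicParametrization euclideanOneEquiv
    (ConnectedComponents.mk (⟨EuclideanSpace.single 0 1, by simp⟩ : UnitCircle))
  exact ⟨q, hq, range_eq_univ.1 (hrange.trans (eq_univ_of_forall fun _ => Subsingleton.elim _ _))⟩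

theorem exists_isLocalDiffeomorph_unitCircle (L : E ≃L[ℝ] ℝ) (M : Type*) [TopologicalSpace M]
    [T2Space M] [CompactSpace M] [ChartedSpace E M] [IsManifold 𝓘(ℝ, E) ∞ M] :
    ∃ g : M → UnitCircle, IsLocalDiffeomorph 𝓘(ℝ, E) (𝓡 1) ∞ g ∧
      ∀ c : ConnectedComponents M, BijOn g (ConnectedComponents.mk ⁻¹' {c}) univ := by
  obtain ⟨q, hq, hqsurj⟩ := exists_surjective_isPeriodicParametrization_unitCircle
  choose γ hγ hrange using exists_isPeriodicParametrization (M := M) L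
  choose t ht using fun x : M => (hrange (ConnectedComponents.mk x)).ge rfl
  have hmk (c : ConnectedComponents M) (s : ℝ) : ConnectedComponents.mk (γ c s) = c :=
    (hrange c).le (mem_range_self s)
  have hfibre (c : ConnectedComponents M) (a b : ℝ) : γ c a = γ c b ↔ q a = q b :=
    ((hγ c).apply_eq_iff a b).trans (hq.apply_eq_iff a b).symm
  have hqt (c : ConnectedComponents M) : (q ∘ t) ∘ γ c = q := funext fun s => by
    have h := ht (γ c s)
    rw [hmk] at h
    exact (hfibre c _ _).1 h
  refine ⟨q ∘ t, fun x => ?_, fun c => ⟨mapsTo_univ _ _, ?_, ?_⟩⟩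
  · rw [← ht x]
    refine isLocalDiffeomorphAt_of_comp ((hγ _).isLocalDiffeomorph _) ?_
    rw [hqt]
    exact hq.isLocalDiffeomorph _
  · rw [← hrange c]
    rintro _ ⟨a, rfl⟩ _ ⟨b, rfl⟩ hab
    exact (hfibre c a b).2 ((congrFun (hqt c) a).symm.trans (hab.trans (congrFun (hqt c) b)))
  · rw [← hrange c]
    intro z _
    obtain ⟨s, rfl⟩ := hqsurj z
    exact ⟨γ c s, mem_range_self s, congrFun (hqt c) s⟩

theorem isFiniteDisjointUnionOfCircles (M : ClosedManifold.{u} 1) :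
    M.IsFiniteDisjointUnionOfCircles := by
  have : LocallyConnectedSpace M := ChartedSpace.locallyConnectedSpace (EuclideanSpace ℝ (Fin 1)) M
  obtain ⟨g, hg, hbij⟩ := exists_isLocalDiffeomorph_unitCircle euclideanOneEquiv M
  let e := Finite.equivFin (ConnectedComponents M)
  let U (i : Fin (Nat.card (ConnectedComponents M))) : TopologicalSpace.Opens M :=
    ⟨ConnectedComponents.mk ⁻¹' {e.symm i},
      (isOpen_discrete _).preimage ConnectedComponents.continuous_coe⟩
  refine ⟨_, U, fun i j hij => ?_, eq_top_iff.2 fun x _ => ?_, fun i => ?_⟩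
  · refine TopologicalSpace.Opens.coe_disjoint.1 ?_
    exact (disjoint_singleton.2 (e.symm.injective.ne hij)).preimage _
  · exact TopologicalSpace.Opens.mem_iSup.2 ⟨e (ConnectedComponents.mk x), by simp [U]⟩
  · have hval := isLocalDiffeomorph_opens_val (I' := 𝓡 1) (n := ∞) (U i)
    have hrestrict : IsLocalDiffeomorph (𝓡 1) (𝓡 1) ∞ (g ∘ (Subtype.val : U i → M)) :=
      fun x => (hval x).comp _ _ (hg x)
    exact ⟨hrestrict.diffeomorphOfBijective ⟨injOn_iff_injective.1 (hbij _).injOn,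
      surjOn_iff_surjective.1 (hbij _).surjOn⟩⟩

end Classification

section RegularDomain

variable {n : ℕ} [NeZero n] {D : Set (EuclideanSpace ℝ (Fin n))}

/-- A smooth change of coordinates on an open subset of `ℝⁿ` that maps the part of `D` in this
subset to the half-space. -/
structure StraighteningChart (D : Set (EuclideanSpace ℝ (Fin n))) where
  chart : OpenPartialHomeomorph (EuclideanSpace ℝ (Fin n)) (EuclideanSpace ℝ (Fin n))
  mem_iff : ∀ x ∈ chart.source, x ∈ D ↔ 0 ≤ chart x 0
  contDiffOn : ContDiffOn ℝ ∞ chart chart.source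
  contDiffOn_symm : ContDiffOn ℝ ∞ chart.symm chart.target

namespace StraighteningChart

variable (ψ ψ' : StraighteningChart D)

theorem coe_symm_chart {x : EuclideanSpace ℝ (Fin n)} (hx : x ∈ ψ.chart.source) (hD : x ∈ D) :
    ((𝓡∂ n).symm (ψ.chart x)).1 = ψ.chart x := by
  refine (𝓡∂ n).right_inv ?_
  rw [range_modelWithCornersEuclideanHalfSpace]
  exact (ψ.mem_iff x hx).1 hD

theorem symm_mem {y : EuclideanHalfSpace n} (hy : y.1 ∈ ψ.chart.target) :
    ψ.chart.symm y.1 ∈ D := by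
  rw [ψ.mem_iff _ (ψ.chart.map_target hy), ψ.chart.right_inv hy]
  exact y.2

open Classical in
/-- The chart of the subspace `D` given by a straightening chart. Off its target the inverse takes
an arbitrary value. -/
noncomputable def restrict [Nonempty D] : OpenPartialHomeomorph D (EuclideanHalfSpace n) where
  toFun x := (𝓡∂ n).symm (ψ.chart x)
  invFun y := if h : ψ.chart.symm y.1 ∈ D then ⟨_, h⟩ else Classical.arbitrary D
  source := Subtype.val ⁻¹' ψ.chart.source
  target := Subtype.val ⁻¹' ψ.chart.target
  map_source' x hx := by
    rw [mem_preimage, ψ.coe_symm_chart hx x.2]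
    exact ψ.chart.map_source hx
  map_target' y hy := by
    rw [dif_pos (ψ.symm_mem hy)]
    exact ψ.chart.map_target hy
  left_inv' x hx := by
    have hinv : ψ.chart.symm ((𝓡∂ n).symm (ψ.chart x)).1 = x := by
      rw [ψ.coe_symm_chart hx x.2, ψ.chart.left_inv hx]
    rw [dif_pos (hinv.symm ▸ x.2 : ψ.chart.symm _ ∈ D)]
    exact Subtype.ext hinv
  right_inv' y hy := by
    rw [dif_pos (ψ.symm_mem hy)]
    simp only [ψ.chart.right_inv hy]
    exact (𝓡∂ n).left_inv y
  open_source := ψ.chart.open_source.preimage continuous_subtype_val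
  open_target := ψ.chart.open_target.preimage continuous_subtype_val
  continuousOn_toFun := (𝓡∂ n).continuous_symm.comp_continuousOn
    (ψ.chart.continuousOn.comp continuous_subtype_val.continuousOn fun _ hx => hx)
  continuousOn_invFun := by
    rw [Topology.IsInducing.subtypeVal.continuousOn_iff]
    refine (ψ.chart.continuousOn_symm.comp continuous_subtype_val.continuousOn
      fun _ hx => hx).congr fun y hy => ?_
    simp only [Function.comp_apply]
    rw [dif_pos (ψ.symm_mem hy)]

variable [Nonempty D]

theorem coe_restrict {x : D} (hx : x.1 ∈ ψ.chart.source) : (ψ.restrict x).1 = ψ.chart x :=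
  ψ.coe_symm_chart hx x.2

theorem coe_restrict_symm {y : EuclideanHalfSpace n} (hy : y.1 ∈ ψ.chart.target) :
    (ψ.restrict.symm y).1 = ψ.chart.symm y.1 :=
  congrArg Subtype.val (dif_pos (ψ.symm_mem hy))

theorem contDiffOn_transition : ContDiffOn ℝ ∞
    ((𝓡∂ n) ∘ (ψ.restrict.symm.trans ψ'.restrict) ∘ (𝓡∂ n).symm)
    ((𝓡∂ n).symm ⁻¹' (ψ.restrict.symm.trans ψ'.restrict).source ∩ range (𝓡∂ n)) := by
  have extends_to_ambient :
      ∀ z ∈ (𝓡∂ n).symm ⁻¹' (ψ.restrict.symm.trans ψ'.restrict).source ∩ range (𝓡∂ n),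
        z ∈ ψ.chart.target ∧ ψ.chart.symm z ∈ ψ'.chart.source ∧
        ((𝓡∂ n) ∘ (ψ.restrict.symm.trans ψ'.restrict) ∘ (𝓡∂ n).symm) z =
          (ψ'.chart ∘ ψ.chart.symm) z := by
    rintro _ ⟨⟨hy, hy'⟩, ⟨y, rfl⟩⟩
    rw [(𝓡∂ n).left_inv] at hy hy'
    replace hy : y.1 ∈ ψ.chart.target := hy
    replace hy' : (ψ.restrict.symm y).1 ∈ ψ'.chart.source := hy'
    simp only [Function.comp_apply, (𝓡∂ n).left_inv]
    exact ⟨hy, ψ.coe_restrict_symm hy ▸ hy',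
      (ψ'.coe_restrict hy').trans (congrArg _ (ψ.coe_restrict_symm hy))⟩
  refine ContDiffOn.congr ?_ fun z hz => (extends_to_ambient z hz).2.2
  exact ψ'.contDiffOn.comp (ψ.contDiffOn_symm.mono fun z hz => (extends_to_ambient z hz).1)
    fun z hz => (extends_to_ambient z hz).2.1

end StraighteningChart

/-- A choice of a straightening chart around each point of `D`, which makes `D` a manifold with
boundary. -/
structure StraighteningAtlas (D : Set (EuclideanSpace ℝ (Fin n))) where
  chartAt : D → StraighteningChart D
  mem_source : ∀ x : D, x.1 ∈ (chartAt x).chart.source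

namespace StraighteningAtlas

variable [Nonempty D] (A : StraighteningAtlas D)

/-- The structure of manifold with boundary on `D` whose charts are the restrictions to `D` of the
straightening charts. -/
@[reducible]
noncomputable def chartedSpace : ChartedSpace (EuclideanHalfSpace n) D where
  atlas := range fun x => (A.chartAt x).restrict
  chartAt x := (A.chartAt x).restrict
  mem_chart_source := A.mem_source
  chart_mem_atlas := mem_range_self

theorem isManifold :
    letI := A.chartedSpace
    IsManifold (𝓡∂ n) ∞ D := by
  let := A.chartedSpace
  refine isManifold_of_contDiffOn _ _ _ ?_
  rintro _ _ ⟨x, rfl⟩ ⟨y, rfl⟩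
  exact (A.chartAt x).contDiffOn_transition (A.chartAt y)

theorem isSmoothEmbedding_val :
    letI := A.chartedSpace
    Manifold.IsSmoothEmbedding (𝓡∂ n) (𝓡 n) ∞ (Subtype.val : D → EuclideanSpace ℝ (Fin n)) := by
  let := A.chartedSpace
  have := A.isManifold
  refine ⟨Manifold.IsImmersionOfComplement.isImmersion (F := PUnit) fun x => ?_, .subtypeVal⟩
  let ψ := A.chartAt x
  refine Manifold.IsImmersionAtOfComplement.mk_of_continuousAt continuous_subtype_val.continuousAt
    (.prodUnique ℝ _ _) ψ.restrict ψ.chart (A.mem_source x) (A.mem_source x)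
    (IsManifold.chart_mem_maximalAtlas x)
    (ψ.chart.mem_maximalAtlas_of_contMDiffOn ψ.contDiffOn.contMDiffOn
      ψ.contDiffOn_symm.contMDiffOn) fun z hz => ?_
  rw [OpenPartialHomeomorph.extend_target] at hz
  obtain ⟨hy, ⟨y, rfl⟩⟩ := hz
  rw [mem_preimage, (𝓡∂ n).left_inv] at hy
  have hval : ψ.chart (ψ.restrict.symm y).1 = y.1 := by
    rw [ψ.coe_restrict_symm hy, ψ.chart.right_inv hy]
  have hmodel : (𝓡∂ n).symm y.1 = y := (𝓡∂ n).left_inv y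
  simpa [OpenPartialHomeomorph.extend, hmodel] using hval

theorem mem_boundary_iff (x : D) :
    letI := A.chartedSpace
    x ∈ (𝓡∂ n).boundary D ↔ (A.chartAt x).chart x.1 0 = 0 := by
  let := A.chartedSpace
  have hext : extChartAt (𝓡∂ n) x x = (A.chartAt x).chart x.1 :=
    (A.chartAt x).coe_restrict (A.mem_source x)
  change extChartAt (𝓡∂ n) x x ∈ frontier (range (𝓡∂ n)) ↔ _
  rw [hext, frontier_range_modelWithCornersEuclideanHalfSpace]
  exact eq_comm

end StraighteningAtlas

end RegularDomain

section Ball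

open Metric Module
open scoped EuclideanSpace

section Polar

variable (E : Type*) [NormedAddCommGroup E] [NormedSpace ℝ E] [Nontrivial E]

/-- Polar coordinates `x ↦ (x / ‖x‖, ‖x‖)` on the complement of the origin. -/
noncomputable def polarCoordinates : OpenPartialHomeomorph E (sphere (0 : E) 1 × ℝ) :=
  let U : TopologicalSpace.Opens E := ⟨{0}ᶜ, isOpen_compl_singleton⟩
  let R : TopologicalSpace.Opens ℝ := ⟨Ioi 0, isOpen_Ioi⟩
  (U.openPartialHomeomorphSubtypeCoe ((exists_ne 0).elim fun x hx => ⟨⟨x, hx⟩⟩)).symm ≫ₕ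
    (homeomorphUnitSphereProd E).toOpenPartialHomeomorph ≫ₕ
    (OpenPartialHomeomorph.refl _).prod (R.openPartialHomeomorphSubtypeCoe ⟨⟨1, one_pos (α := ℝ)⟩⟩)

@[simp]
theorem polarCoordinates_source : (polarCoordinates E).source = {0}ᶜ := by
  ext x
  simp [polarCoordinates]

@[simp]
theorem polarCoordinates_target : (polarCoordinates E).target = univ ×ˢ Ioi 0 := by
  ext x
  simp [polarCoordinates]

variable {E}

theorem polarCoordinates_coe_compl (x : ({0}ᶜ : Set E)) :
    polarCoordinates E x = ((homeomorphUnitSphereProd E x).1, ‖(x : E)‖) := by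
  let U : TopologicalSpace.Opens E := ⟨{0}ᶜ, isOpen_compl_singleton⟩
  have symm_coe : (U.openPartialHomeomorphSubtypeCoe ⟨x⟩).symm (x : E) = x :=
    (U.openPartialHomeomorphSubtypeCoe ⟨x⟩).left_inv (mem_univ x)
  have : polarCoordinates E x =
      ((homeomorphUnitSphereProd E x).1, ((homeomorphUnitSphereProd E x).2 : ℝ)) :=
    congrArg (fun y : U => ((homeomorphUnitSphereProd E y).1,
      ((homeomorphUnitSphereProd E y).2 : ℝ))) symm_coe
  rw [this, homeomorphUnitSphereProd_apply_snd_coe]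

theorem coe_polarCoordinates_fst {x : E} (hx : x ≠ 0) :
    ((polarCoordinates E x).1 : E) = ‖x‖⁻¹ • x := by
  rw [polarCoordinates_coe_compl ⟨x, hx⟩, homeomorphUnitSphereProd_apply_fst_coe]

theorem polarCoordinates_snd {x : E} (hx : x ≠ 0) : (polarCoordinates E x).2 = ‖x‖ := by
  rw [polarCoordinates_coe_compl ⟨x, hx⟩]

theorem polarCoordinates_coe_sphere (x : sphere (0 : E) 1) : polarCoordinates E x = (x, 1) := by
  have hx : (x : E) ≠ 0 := ne_zero_of_mem_unit_sphere x
  refine Prod.ext (Subtype.ext ?_) ?_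
  · rw [coe_polarCoordinates_fst hx, norm_eq_of_mem_sphere, inv_one, one_smul]
  · rw [polarCoordinates_snd hx, norm_eq_of_mem_sphere]

theorem polarCoordinates_symm_apply {p : sphere (0 : E) 1 × ℝ} (hp : 0 < p.2) :
    (polarCoordinates E).symm p = p.2 • (p.1 : E) := by
  have hne : p.2 • (p.1 : E) ≠ 0 := smul_ne_zero hp.ne' (ne_zero_of_mem_unit_sphere p.1)
  have hnorm : ‖p.2 • (p.1 : E)‖ = p.2 := by
    rw [norm_smul, norm_eq_of_mem_sphere, mul_one, Real.norm_of_nonneg hp.le]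
  have : polarCoordinates E (p.2 • (p.1 : E)) = p := by
    refine Prod.ext (Subtype.ext ?_) ?_
    · rw [coe_polarCoordinates_fst hne, hnorm, inv_smul_smul₀ hp.ne']
    · rw [polarCoordinates_snd hne, hnorm]
  rw [← this, (polarCoordinates E).left_inv (by simpa using hne), this]

end Polar

section PolarSmooth

variable {E : Type*} [NormedAddCommGroup E] [InnerProductSpace ℝ E] [Nontrivial E] {n : ℕ}
  [Fact (finrank ℝ E = n + 1)]

theorem contMDiffOn_polarCoordinates :
    ContMDiffOn 𝓘(ℝ, E) ((𝓡 n).prod 𝓘(ℝ, ℝ)) ∞ (polarCoordinates E) {0}ᶜ := by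
  intro x hx
  let U : TopologicalSpace.Opens E := ⟨{0}ᶜ, isOpen_compl_singleton⟩
  have hne (y : U) : (y : E) ≠ 0 := y.2
  have coe_fst : ContMDiff 𝓘(ℝ, E) 𝓘(ℝ, E) ∞ fun y : U => ((polarCoordinates E y).1 : E) := by
    intro y
    have normalize : ContDiffAt ℝ ∞ (fun z : E => ‖z‖⁻¹ • z) y :=
      ((contDiffAt_norm ℝ (hne y)).inv (norm_ne_zero_iff.2 (hne y))).smul contDiffAt_id
    exact (normalize.contMDiffAt.comp y (contMDiff_subtype_val y)).congr_of_eventuallyEq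
      (Eventually.of_forall fun z => coe_polarCoordinates_fst (hne z))
  have fst : ContMDiffAt 𝓘(ℝ, E) (𝓡 n) ∞ (fun y => (polarCoordinates E y).1) x :=
    (contMDiffAt_subtype_iff (U := U) (x := ⟨x, hx⟩)).1
      (coe_fst.codRestrict_sphere (fun y => (polarCoordinates E y).1.2) ⟨x, hx⟩)
  have snd : ContMDiffAt 𝓘(ℝ, E) 𝓘(ℝ, ℝ) ∞ (fun y => (polarCoordinates E y).2) x := by
    refine (contDiffAt_norm ℝ hx).contMDiffAt.congr_of_eventuallyEq ?_
    filter_upwards [isOpen_compl_singleton.mem_nhds hx] with y hy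
    exact polarCoordinates_snd hy
  exact (fst.prodMk snd).contMDiffWithinAt

theorem contMDiffOn_polarCoordinates_symm :
    ContMDiffOn ((𝓡 n).prod 𝓘(ℝ, ℝ)) 𝓘(ℝ, E) ∞ (polarCoordinates E).symm (univ ×ˢ Ioi 0) := by
  refine ContMDiffOn.congr (ContMDiff.contMDiffOn ?_) fun p hp => polarCoordinates_symm_apply hp.2
  exact contMDiff_snd.smul ((contMDiff_coe_sphere (n := n)).comp contMDiff_fst)

end PolarSmooth

section StandardAtlas

variable {n : ℕ}

/-- Coordinates of the sphere together with a radial coordinate as coordinates of `ℝⁿ⁺¹`. The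
radial coordinate comes first because the half-space is cut out by its coordinate `0`. -/
noncomputable def collarEquiv :
    (EuclideanSpace ℝ (Fin n) × ℝ) ≃L[ℝ] EuclideanSpace ℝ (Fin (n + 1)) :=
  (ContinuousLinearEquiv.prodComm ℝ _ _).trans <|
    ((ContinuousLinearEquiv.refl ℝ ℝ).prodCongr (EuclideanSpace.equiv (Fin n) ℝ)).trans <|
      (Fin.consEquivL ℝ fun _ => ℝ).trans (EuclideanSpace.equiv (Fin (n + 1)) ℝ).symm

theorem collarEquiv_apply_zero (p : EuclideanSpace ℝ (Fin n) × ℝ) : collarEquiv p 0 = p.2 := rfl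

/-- Collar coordinates around the unit sphere: a chart of the sphere applied to the direction of a
point, together with `1` minus the norm. -/
noncomputable def collarChart
    (φ : OpenPartialHomeomorph (sphere (0 : EuclideanSpace ℝ (Fin (n + 1))) 1)
      (EuclideanSpace ℝ (Fin n))) :
    OpenPartialHomeomorph (EuclideanSpace ℝ (Fin (n + 1))) (EuclideanSpace ℝ (Fin (n + 1))) :=
  (polarCoordinates _ ≫ₕ
    φ.prod (Homeomorph.subLeft (1 : ℝ)).toOpenPartialHomeomorph).transHomeomorph
      collarEquiv.toHomeomorph

variable {φ : OpenPartialHomeomorph (sphere (0 : EuclideanSpace ℝ (Fin (n + 1))) 1)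
  (EuclideanSpace ℝ (Fin n))}

theorem collarChart_coe_sphere (x : sphere (0 : EuclideanSpace ℝ (Fin (n + 1))) 1) :
    collarChart φ x = collarEquiv (φ x, 0) := by
  change collarEquiv (φ (polarCoordinates _ (x : EuclideanSpace ℝ (Fin (n + 1)))).1,
    1 - (polarCoordinates _ (x : EuclideanSpace ℝ (Fin (n + 1)))).2) = _
  rw [polarCoordinates_coe_sphere, sub_self]

theorem mem_collarChart_source {x : EuclideanSpace ℝ (Fin (n + 1))} :
    x ∈ (collarChart φ).source ↔ x ≠ 0 ∧ (polarCoordinates _ x).1 ∈ φ.source := by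
  simp [collarChart]

theorem mem_collarChart_target {y : EuclideanSpace ℝ (Fin (n + 1))} :
    y ∈ (collarChart φ).target ↔
      (collarEquiv.symm y).1 ∈ φ.target ∧ (collarEquiv.symm y).2 < 1 := by
  simp [collarChart]

/-- The straightening chart of the unit ball that extends a chart of its boundary sphere. -/
noncomputable def collarStraighteningChart
    (hφ : φ ∈ IsManifold.maximalAtlas (𝓡 n) ∞ (sphere (0 : EuclideanSpace ℝ (Fin (n + 1))) 1)) :
    StraighteningChart (closedBall (0 : EuclideanSpace ℝ (Fin (n + 1))) 1) where
  chart := collarChart φ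
  mem_iff x hx := by
    change _ ↔ 0 ≤ 1 - (polarCoordinates _ x).2
    rw [polarCoordinates_snd (mem_collarChart_source.1 hx).1, mem_closedBall_zero_iff, sub_nonneg]
  contDiffOn := by
    have polar := (contMDiffOn_polarCoordinates (E := EuclideanSpace ℝ (Fin (n + 1))) (n := n)).mono
      fun x (hx : x ∈ (collarChart φ).source) => (mem_collarChart_source.1 hx).1
    have fst := (contMDiffOn_of_mem_maximalAtlas hφ).comp (contMDiff_fst.comp_contMDiffOn polar)
      fun x hx => (mem_collarChart_source.1 hx).2
    have snd := contMDiff_snd.comp_contMDiffOn polar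
    exact collarEquiv.contDiff.comp_contDiffOn ((contMDiffOn_iff_contDiffOn.1 fst).prodMk
      (contDiffOn_const.sub (contMDiffOn_iff_contDiffOn.1 snd)))
  contDiffOn_symm := by
    let f (y : EuclideanSpace ℝ (Fin (n + 1))) :
        sphere (0 : EuclideanSpace ℝ (Fin (n + 1))) 1 × ℝ :=
      (φ.symm (collarEquiv.symm y).1, -(collarEquiv.symm y).2 + 1)
    have fst : ContDiff ℝ ∞ fun y : EuclideanSpace ℝ (Fin (n + 1)) => (collarEquiv.symm y).1 := by
      fun_prop
    have snd : ContDiff ℝ ∞ fun y : EuclideanSpace ℝ (Fin (n + 1)) =>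
        -(collarEquiv.symm y).2 + 1 := by
      fun_prop
    have hf : ContMDiffOn (𝓡 (n + 1)) ((𝓡 n).prod 𝓘(ℝ, ℝ)) ∞ f (collarChart φ).target :=
      ((contMDiffOn_symm_of_mem_maximalAtlas hφ).comp fst.contMDiff.contMDiffOn
        fun y hy => (mem_collarChart_target.1 hy).1).prodMk snd.contMDiff.contMDiffOn
    have mapsTo : MapsTo f (collarChart φ).target (univ ×ˢ Ioi 0) := fun y hy =>
      ⟨mem_univ _, by simpa [f] using (mem_collarChart_target.1 hy).2⟩
    exact contMDiffOn_iff_contDiffOn.1 (contMDiffOn_polarCoordinates_symm.comp hf mapsTo)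

theorem apply_zero_add_single_two_pos {x : EuclideanSpace ℝ (Fin (n + 1))} (hx : x ∈ ball 0 1) :
    0 < (x + EuclideanSpace.single 0 2 : EuclideanSpace ℝ (Fin (n + 1))) 0 := by
  have := (abs_lt.1 ((PiLp.norm_apply_le x 0).trans_lt (mem_ball_zero_iff.1 hx))).1
  rw [PiLp.add_apply, PiLp.single_apply, if_pos rfl]
  linarith

/-- The straightening chart of the unit ball on its interior, a translation into the interior of the
half-space. -/
noncomputable def interiorStraighteningChart (n : ℕ) :
    StraighteningChart (closedBall (0 : EuclideanSpace ℝ (Fin (n + 1))) 1) where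
  chart := (Homeomorph.addRight (EuclideanSpace.single 0 2)).toOpenPartialHomeomorph.restrOpen
    (ball 0 1) isOpen_ball
  mem_iff _ hx := iff_of_true (ball_subset_closedBall hx.2) (apply_zero_add_single_two_pos hx.2).le
  contDiffOn := (contDiff_id.add contDiff_const).contDiffOn
  contDiffOn_symm := (contDiff_id.add contDiff_const).contDiffOn

open Classical in
/-- The straightening charts of the unit ball: collar charts around the boundary sphere and a
translation around the points of the interior. -/
noncomputable def ballStraighteningAtlas (n : ℕ) :
    StraighteningAtlas (closedBall (0 : EuclideanSpace ℝ (Fin (n + 1))) 1) where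
  chartAt x :=
    if h : x.1 ∈ sphere (0 : EuclideanSpace ℝ (Fin (n + 1))) 1 then
      collarStraighteningChart (φ := chartAt (EuclideanSpace ℝ (Fin n)) ⟨x.1, h⟩)
        (IsManifold.chart_mem_maximalAtlas _)
    else interiorStraighteningChart n
  mem_source x := by
    split_ifs with h
    · refine mem_collarChart_source.2 ⟨ne_zero_of_mem_unit_sphere ⟨x.1, h⟩, ?_⟩
      rw [polarCoordinates_coe_sphere ⟨x.1, h⟩]
      exact mem_chart_source _ _
    · rw [mem_sphere_zero_iff_norm] at h
      exact ⟨mem_univ _, mem_ball_zero_iff.2 (lt_of_le_of_ne (mem_closedBall_zero_iff.1 x.2) h)⟩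

instance : Nonempty (closedBall (0 : EuclideanSpace ℝ (Fin (n + 1))) 1) :=
  ⟨⟨0, mem_closedBall_self zero_le_one⟩⟩

noncomputable instance : ChartedSpace (EuclideanHalfSpace (n + 1))
    (closedBall (0 : EuclideanSpace ℝ (Fin (n + 1))) 1) :=
  (ballStraighteningAtlas n).chartedSpace

instance : IsManifold (𝓡∂ (n + 1)) ∞ (closedBall (0 : EuclideanSpace ℝ (Fin (n + 1))) 1) :=
  (ballStraighteningAtlas n).isManifold

theorem isSmoothEmbedding_closedBall_val :
    Manifold.IsSmoothEmbedding (𝓡∂ (n + 1)) (𝓡 (n + 1)) ∞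
      (Subtype.val : closedBall (0 : EuclideanSpace ℝ (Fin (n + 1))) 1 → _) :=
  (ballStraighteningAtlas n).isSmoothEmbedding_val

theorem chart_ballStraighteningAtlas_inclusion
    (x : sphere (0 : EuclideanSpace ℝ (Fin (n + 1))) 1) :
    ((ballStraighteningAtlas n).chartAt (inclusion sphere_subset_closedBall x)).chart =
      collarChart (chartAt (EuclideanSpace ℝ (Fin n)) x) :=
  congrArg StraighteningChart.chart (dif_pos x.2)

theorem ballStraighteningAtlas_chartAt_of_notMem_sphere
    {x : closedBall (0 : EuclideanSpace ℝ (Fin (n + 1))) 1} (hx : x.1 ∉ sphere 0 1) :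
    (ballStraighteningAtlas n).chartAt x = interiorStraighteningChart n :=
  dif_neg hx

theorem boundary_closedBall :
    (𝓡∂ (n + 1)).boundary (closedBall (0 : EuclideanSpace ℝ (Fin (n + 1))) 1) =
      Subtype.val ⁻¹' sphere 0 1 := by
  ext x
  refine ((ballStraighteningAtlas n).mem_boundary_iff x).trans ?_
  by_cases hx : x.1 ∈ sphere (0 : EuclideanSpace ℝ (Fin (n + 1))) 1
  · refine iff_of_true ?_ hx
    obtain ⟨x, rfl⟩ : ∃ y, inclusion sphere_subset_closedBall y = x := ⟨⟨x.1, hx⟩, rfl⟩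
    rw [chart_ballStraighteningAtlas_inclusion, coe_inclusion, collarChart_coe_sphere,
      collarEquiv_apply_zero]
  · have mem_ball := (ballStraighteningAtlas n).mem_source x
    rw [ballStraighteningAtlas_chartAt_of_notMem_sphere hx] at mem_ball ⊢
    exact iff_of_false (apply_zero_add_single_two_pos mem_ball.2).ne' hx

theorem isImmersionAtOfComplement_inclusion_sphere
    (x : sphere (0 : EuclideanSpace ℝ (Fin (n + 1))) 1) :
    Manifold.IsImmersionAtOfComplement ℝ (𝓡 n) (𝓡∂ (n + 1)) ∞
      (inclusion (sphere_subset_closedBall (x := 0) (ε := 1))) x := by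
  let φ := chartAt (EuclideanSpace ℝ (Fin n)) x
  let ψ := (ballStraighteningAtlas n).chartAt (inclusion sphere_subset_closedBall x)
  have hψ : ψ.chart = collarChart φ := chart_ballStraighteningAtlas_inclusion x
  refine Manifold.IsImmersionAtOfComplement.mk_of_continuousAt
    (continuous_inclusion sphere_subset_closedBall).continuousAt collarEquiv φ
    (chartAt (EuclideanHalfSpace (n + 1)) _) (mem_chart_source _ _) (mem_chart_source _ _)
    (IsManifold.chart_mem_maximalAtlas _) (IsManifold.chart_mem_maximalAtlas _) fun z hz => ?_
  rw [OpenPartialHomeomorph.extend_target] at hz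
  have hz' : z ∈ φ.target := hz.1
  have mem_source : (φ.symm z : EuclideanSpace ℝ (Fin (n + 1))) ∈ ψ.chart.source := by
    rw [hψ, mem_collarChart_source, polarCoordinates_coe_sphere]
    exact ⟨ne_zero_of_mem_unit_sphere _, φ.map_target hz'⟩
  have : (ψ.restrict (inclusion sphere_subset_closedBall (φ.symm z))).1 = collarEquiv (z, 0) := by
    refine (ψ.coe_restrict mem_source).trans ?_
    rw [hψ]
    refine (collarChart_coe_sphere (φ.symm z)).trans ?_
    rw [φ.right_inv hz']
  exact this

end StandardAtlas

end Ball

section PullbackChartedSpace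

variable {𝕜 : Type*} [NontriviallyNormedField 𝕜] {E E' F : Type*} [NormedAddCommGroup E]
  [NormedSpace 𝕜 E] [NormedAddCommGroup E'] [NormedSpace 𝕜 E'] [NormedAddCommGroup F]
  [NormedSpace 𝕜 F] {H H' : Type*} [TopologicalSpace H] [TopologicalSpace H']
  {I : ModelWithCorners 𝕜 E H} {J : ModelWithCorners 𝕜 E' H'}
  {X Y M N : Type*} [TopologicalSpace X] [TopologicalSpace Y]
  [TopologicalSpace M] [ChartedSpace H' M] [TopologicalSpace N] [ChartedSpace H' N]
  {f : X → Y} {n : ℕ∞ω}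

theorem symm_trans_trans_mem_of_coe_eq (G : StructureGroupoid H) [ClosedUnderRestriction G]
    {e e' : OpenPartialHomeomorph X Y} (he : ⇑e = f) (he' : ⇑e' = f)
    {φ φ' : OpenPartialHomeomorph Y H} (hφ : φ.symm.trans φ' ∈ G) :
    (e.trans φ).symm.trans (e'.trans φ') ∈ G := by
  let transition := (e.trans φ).symm.trans (e'.trans φ')
  have on_source : ∀ z ∈ transition.source,
      z ∈ φ.target ∧ φ.symm z ∈ φ'.source ∧ f (e.symm (φ.symm z)) = φ.symm z := by
    rintro z ⟨⟨hz, hz_target⟩, -, hz_source⟩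
    have f_symm : f (e.symm (φ.symm z)) = φ.symm z := he ▸ e.right_inv hz_target
    replace hz_source : e' (e.symm (φ.symm z)) ∈ φ'.source := hz_source
    rw [he', f_symm] at hz_source
    exact ⟨hz, hz_source, f_symm⟩
  refine G.mem_of_eqOnSource (closedUnderRestriction' hφ transition.open_source)
    ⟨?_, fun z hz => ?_⟩
  · rw [OpenPartialHomeomorph.restr_source, transition.open_source.interior_eq]
    have : transition.source ⊆ (φ.symm.trans φ').source :=
      fun z hz => ⟨(on_source z hz).1, (on_source z hz).2.1⟩
    exact (inter_eq_right.2 this).symm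
  · change φ' (e' (e.symm (φ.symm z))) = φ' (φ.symm z)
    rw [he', (on_source z hz).2.2]

variable [ChartedSpace H Y]

theorem isImmersionAtOfComplement_comp_isLocalDiffeomorphAt [IsManifold J n M] {f : N → Y}
    {g : M → N} {x : M} (hf : Manifold.IsImmersionAtOfComplement F J I n f (g x))
    (hf_cont : ContinuousAt f (g x)) (hg : IsLocalDiffeomorphAt J J n g x) :
    Manifold.IsImmersionAtOfComplement F J I n (f ∘ g) x := by
  have hg_cont : ContinuousAt g x := hg.contMDiffAt.continuousAt
  obtain ⟨Φ, hx, hΦ⟩ := hg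
  refine Manifold.IsImmersionAtOfComplement.mk_of_continuousAt (hf_cont.comp hg_cont) hf.equiv
    (Φ.toOpenPartialHomeomorph.trans hf.domChart) hf.codChart
    ⟨hx, ?_⟩ hf.mem_codChart_source ?_ hf.codChart_mem_maximalAtlas fun z hz => ?_
  · change Φ x ∈ hf.domChart.source
    rw [← hΦ hx]
    exact hf.mem_domChart_source
  · refine OpenPartialHomeomorph.mem_maximalAtlas_of_contMDiffOn _ ?_ ?_
    · exact (contMDiffOn_of_mem_maximalAtlas hf.domChart_mem_maximalAtlas).comp
        (Φ.contMDiffOn_toFun.mono fun y hy => hy.1) fun y hy => hy.2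
    · exact Φ.contMDiffOn_invFun.comp ((contMDiffOn_symm_of_mem_maximalAtlas
        hf.domChart_mem_maximalAtlas).mono fun y hy => hy.1) fun y hy => hy.2
  · rw [OpenPartialHomeomorph.extend_target] at hz
    obtain ⟨⟨hz_dom, hz_target⟩, hz_range⟩ := hz
    replace hz_target : hf.domChart.symm (J.symm z) ∈ Φ.target := hz_target
    have g_symm : g (Φ.invFun (hf.domChart.symm (J.symm z))) = hf.domChart.symm (J.symm z) :=
      (hΦ (Φ.map_target hz_target)).trans (Φ.right_inv hz_target)
    have hz' : z ∈ (hf.domChart.extend J).target := by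
      rw [OpenPartialHomeomorph.extend_target]
      exact ⟨hz_dom, hz_range⟩
    exact (congrArg (hf.codChart.extend I ∘ f) g_symm).trans (hf.writtenInCharts hz')

/-- The structure of charted space pulled back by a local homeomorphism. -/
@[reducible]
noncomputable def pullbackChartedSpace (hf : IsLocalHomeomorph f) : ChartedSpace H X where
  atlas := {ψ | ∃ e : OpenPartialHomeomorph X Y, ⇑e = f ∧ ∃ φ ∈ atlas H Y, ψ = e.trans φ}
  chartAt x := (hf x).choose.trans (chartAt H (f x))
  mem_chart_source x := by
    obtain ⟨hx, hfx⟩ := (hf x).choose_spec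
    refine ⟨hx, ?_⟩
    change (hf x).choose x ∈ (chartAt H (f x)).source
    rw [← hfx]
    exact mem_chart_source H (f x)
  chart_mem_atlas x := ⟨_, (hf x).choose_spec.2.symm, _, chart_mem_atlas H _, rfl⟩

namespace pullbackChartedSpace

variable (hf : IsLocalHomeomorph f)

theorem isManifold [IsManifold I n Y] :
    letI : ChartedSpace H X := pullbackChartedSpace hf
    IsManifold I n X := by
  let : ChartedSpace H X := pullbackChartedSpace hf
  refine IsManifold.mk' (gr := ⟨?_⟩) I n X
  rintro _ _ ⟨e, he, φ, hφ, rfl⟩ ⟨e', he', φ', hφ', rfl⟩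
  exact symm_trans_trans_mem_of_coe_eq _ he he' (HasGroupoid.compatible hφ hφ')

theorem trans_mem_maximalAtlas {e : OpenPartialHomeomorph X Y} (he : ⇑e = f)
    {φ : OpenPartialHomeomorph Y H} (hφ : φ ∈ IsManifold.maximalAtlas I n Y) :
    letI : ChartedSpace H X := pullbackChartedSpace hf
    e.trans φ ∈ IsManifold.maximalAtlas I n X := by
  let : ChartedSpace H X := pullbackChartedSpace hf
  rintro _ ⟨e', he', φ', hφ', rfl⟩
  obtain ⟨hφφ', hφ'φ⟩ := hφ φ' hφ'
  exact ⟨symm_trans_trans_mem_of_coe_eq _ he he' hφφ', symm_trans_trans_mem_of_coe_eq _ he' he hφ'φ⟩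

theorem mem_boundary_iff (x : X) :
    letI : ChartedSpace H X := pullbackChartedSpace hf
    x ∈ I.boundary X ↔ f x ∈ I.boundary Y := by
  let : ChartedSpace H X := pullbackChartedSpace hf
  have extChartAt_eq : extChartAt I x x = extChartAt I (f x) (f x) := by
    change I (chartAt H (f x) ((hf x).choose x)) = I (chartAt H (f x) (f x))
    rw [← (hf x).choose_spec.2]
  change extChartAt I x x ∈ frontier (range I) ↔ extChartAt I (f x) (f x) ∈ frontier (range I)
  rw [extChartAt_eq]

theorem isImmersionAtOfComplement_of_comp {ι : M → X} {x : M} (hι : ContinuousAt ι x)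
    (h : Manifold.IsImmersionAtOfComplement F J I n (f ∘ ι) x) :
    letI : ChartedSpace H X := pullbackChartedSpace hf
    Manifold.IsImmersionAtOfComplement F J I n ι x := by
  let : ChartedSpace H X := pullbackChartedSpace hf
  obtain ⟨e, hxe, rfl⟩ := hf (ι x)
  exact Manifold.IsImmersionAtOfComplement.mk_of_continuousAt hι h.equiv h.domChart
    (e.trans h.codChart) h.mem_domChart_source ⟨hxe, h.mem_codChart_source⟩
    h.domChart_mem_maximalAtlas
    (trans_mem_maximalAtlas hf rfl h.codChart_mem_maximalAtlas) h.writtenInCharts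

end pullbackChartedSpace

end PullbackChartedSpace

theorem isLocalHomeomorph_snd {D Y : Type*} [TopologicalSpace D] [DiscreteTopology D]
    [TopologicalSpace Y] : IsLocalHomeomorph (Prod.snd : D × Y → Y) := fun p =>
  ⟨{ toFun := Prod.snd
     invFun := fun y => (p.1, y)
     source := {p.1} ×ˢ univ
     target := univ
     map_source' := fun _ _ => mem_univ _
     map_target' := fun _ _ => ⟨rfl, mem_univ _⟩
     left_inv' := fun _ hq => Prod.ext hq.1.symm rfl
     right_inv' := fun _ _ => rfl
     open_source := (isOpen_discrete _).prod isOpen_univ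
     open_target := isOpen_univ
     continuousOn_toFun := continuous_snd.continuousOn
     continuousOn_invFun := by fun_prop }, ⟨rfl, mem_univ _⟩, rfl⟩

section Cobordism

open Metric

theorem everyCircleBoundsDisc : EveryCircleBoundsDisc.{u} := by
  refine ⟨inferInstance, inferInstance, isSmoothEmbedding_closedBall_val, fun C Φ => ⟨⟨?_, ?_⟩, ?_⟩⟩
  · exact Manifold.IsImmersionOfComplement.isImmersion (F := ℝ) fun c =>
      isImmersionAtOfComplement_comp_isLocalDiffeomorphAt
        (isImmersionAtOfComplement_inclusion_sphere (Φ c))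
        (continuous_inclusion sphere_subset_closedBall).continuousAt (Φ.isLocalDiffeomorph c)
  · exact (IsEmbedding.inclusion sphere_subset_closedBall).comp Φ.toHomeomorph.isEmbedding
  · exact (Φ.surjective.range_comp circleToDisc).trans
      ((range_inclusion sphere_subset_closedBall).trans boundary_closedBall.symm)

namespace ClosedManifold

theorem exists_isBoundaryParametrization_of_bijOn_sphere {n : ℕ} (M : ClosedManifold.{u} n)
    {D : Type u} [TopologicalSpace D] [DiscreteTopology D] [Finite D] {p : M → D}
    (hp : Continuous p) {g : M → sphere (0 : EuclideanSpace ℝ (Fin (n + 1))) 1}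
    (hg : IsLocalDiffeomorph (𝓡 n) (𝓡 n) ∞ g) (hbij : ∀ d, BijOn g (p ⁻¹' {d}) univ) :
    ∃ (W : Type u) (_ : TopologicalSpace W) (_ : ChartedSpace (EuclideanHalfSpace (n + 1)) W),
      T2Space W ∧ CompactSpace W ∧ IsManifold (𝓡∂ (n + 1)) ∞ W ∧
        ∃ ι : M → W, IsBoundaryParametrization n ι := by
  let W := D × closedBall (0 : EuclideanSpace ℝ (Fin (n + 1))) 1
  have snd_loc : IsLocalHomeomorph fun w : W => w.2 := isLocalHomeomorph_snd
  let : ChartedSpace (EuclideanHalfSpace (n + 1)) W := pullbackChartedSpace snd_loc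
  have incl_cont := continuous_inclusion
    (sphere_subset_closedBall (x := (0 : EuclideanSpace ℝ (Fin (n + 1)))) (ε := 1))
  let ι : M → W := fun x => (p x, inclusion sphere_subset_closedBall (g x))
  have ι_cont : Continuous ι := hp.prodMk (incl_cont.comp hg.contMDiff.continuous)
  have ι_inj : Function.Injective ι := fun x y hxy =>
    (hbij (p y)).injOn (congrArg Prod.fst hxy) rfl
      (inclusion_injective sphere_subset_closedBall (congrArg Prod.snd hxy))
  have ι_imm : Manifold.IsImmersionOfComplement ℝ (𝓡 n) (𝓡∂ (n + 1)) ∞ ι := fun x =>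
    pullbackChartedSpace.isImmersionAtOfComplement_of_comp snd_loc ι_cont.continuousAt
      (isImmersionAtOfComplement_comp_isLocalDiffeomorphAt (f := inclusion _) (g := g)
        (isImmersionAtOfComplement_inclusion_sphere (g x)) incl_cont.continuousAt (hg x))
  have range_ι : range ι = (𝓡∂ (n + 1)).boundary W := by
    ext ⟨d, y⟩
    refine Iff.trans ?_ (pullbackChartedSpace.mem_boundary_iff snd_loc (d, y)).symm
    rw [boundary_closedBall]
    refine ⟨?_, fun hy => ?_⟩
    · rintro ⟨x, hx⟩
      exact congrArg Prod.snd hx ▸ (g x).2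
    · obtain ⟨x, rfl, hx⟩ := (hbij d).surjOn (mem_univ ⟨y.1, hy⟩)
      exact ⟨x, Prod.ext rfl (congrArg (inclusion sphere_subset_closedBall) hx)⟩
  exact ⟨W, inferInstance, inferInstance, inferInstance, inferInstance,
    pullbackChartedSpace.isManifold snd_loc, ι,
    ⟨ι_imm.isImmersion, (ι_cont.isClosedEmbedding ι_inj).isEmbedding⟩, range_ι⟩

/-- The disjoint union of two closed manifolds. -/
noncomputable def sum {n : ℕ} (M N : ClosedManifold.{u} n) : ClosedManifold.{u} n where
  carrier := M ⊕ N

theorem cobordant_of_dim_one (M N : ClosedManifold.{u} 1) : Cobordant M N := by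
  have := ChartedSpace.locallyConnectedSpace (EuclideanSpace ℝ (Fin 1)) (M.sum N)
  obtain ⟨g, hg, hbij⟩ := exists_isLocalDiffeomorph_unitCircle euclideanOneEquiv (M.sum N)
  exact (M.sum N).exists_isBoundaryParametrization_of_bijOn_sphere
    ConnectedComponents.continuous_coe hg hbij

end ClosedManifold

end Cobordism

theorem mainTheorem6 :
    (∀ M : ClosedManifold.{u} 1, M.IsFiniteDisjointUnionOfCircles) ∧
    EveryCircleBoundsDisc.{u} ∧
    (∀ M : ClosedManifold.{u} 1, M.Nullbordant) ∧
    (∃ h : Equivalence (ClosedManifold.Cobordant (n := 1) : ClosedManifold.{u} 1 → _ → Prop),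
      Nat.card (Quotient (Setoid.mk _ h)) = 1) := by
  have cobordant := ClosedManifold.cobordant_of_dim_one.{u}
  refine ⟨fun M => isFiniteDisjointUnionOfCircles M, everyCircleBoundsDisc,
    fun M => cobordant M _,
    ⟨fun _ => cobordant _ _, fun _ => cobordant _ _, fun _ _ => cobordant _ _⟩, ?_⟩
  rw [Nat.card_eq_one_iff_unique]
  exact ⟨⟨Quotient.ind₂ fun M N => Quotient.sound (cobordant M N)⟩, ⟨Quotient.mk _ (.empty 1)⟩⟩
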